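/- Let $d,K,n,m\ge 1$ be integers. For $\theta=[\mu,\sigma]\in\mathbb{R}^{2d}$ with $\mu\in\mathbb{R}^d$ and $\sigma=(\sigma_1^2,\dots,\sigma_d^2)\in(0,\infty)^d$, let $P_\theta=\mathcal N(\mu,\mathrm{diag}(\sigma_1^2,\dots,\sigma_d^2))$. Let $\mathcal T\subset\mathbb{R}^d\times(0,\infty)^d\subset\mathbb{R}^{2d}$ be non-empty and compact, and let $$\Sigma=\Big\{\sum_{k=1}^K\alpha_kP_{\theta_k}\;:\;\theta_k\in\mathcal T,\ \alpha_k\ge 0,\ \sum_{k=1}^K\alpha_k=1\Big\}$$ be the set of $K$-component Gaussian mixtures with diagonal covariances and parameters in $\mathcal T$. Put $\sigma_{\min}^2=\min_{[\mu,\sigma]\in\mathcal T}\min_{\ell}\sigma_\ell^2$, let $\mathrm{rad}(\mathcal T)$ be the infimum of the $r>0$ such that $\mathcal T$ is contained in a closed Euclidean ball of radius $r$ in $\mathbb{R}^{2d}$, and let $$B=8\max\big(\sigma_{\min}^{-1},\,\sigma_{\min}^{-2}/\sqrt2\big)\,\mathrm{rad}(\mathcal T),\qquad C=\sqrt{48(B+1)}.$$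 For a probability measure $P$ on $\mathbb{R}^d$ let $\psi_P(\omega)=\int e^{-\mathsf i\,\omega^Tx}\,dP(x)$. For frequencies $\omega_1,\dots,\omega_m\in\mathbb{R}^d$ let $\mathcal A P=\frac1{\sqrt m}\,[\psi_P(\omega_1),\dots,\psi_P(\omega_m)]^T\in\mathbb{C}^m$. For a probability measure $\Lambda$ on $\mathbb{R}^d$ (the frequency distribution) let $\gamma_\Lambda(P,Q)=\big(\int|\psi_P(\omega)-\psi_Q(\omega)|^2\,d\Lambda(\omega)\big)^{1/2}$ be the maximum mean discrepancy. Let $\|\nu\|_{TV}=|\nu|(\mathbb{R}^d)$ be the total variation norm of a finite signed measure, and $d_{TV}(P,\Sigma)=\inf_{Q\in\Sigma}\|P-Q\|_{TV}$. Let $\Lambda$ and $P^*$ be arbitrary probability measures on $\mathbb{R}^d$, let $0<\eta\le1$ and $\rho>0$, and suppose that $$m\ \ge\ 48\,\eta^{-2}\Big(2K(2d+1)\log\frac{C}{\eta}+\log\frac2\rho\Big).$$ Let $x_1,\dots,x_n$ be drawn i.i.d. from $P^*$ and $\omega_1,\dots,\omega_m$ be drawn i.i.d. from $\Lambda$, independently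 of the $x_i$. Let $\hat z=\mathcal A\hat P$ be the sketch of the empirical distribution $\hat P=\frac1n\sum_{i=1}^n\delta_{x_i}$. Then the problem $\min_{P\in\Sigma}\|z-\mathcal A P\|_2$ has a solution for every $z\in\mathbb{C}^m$ and all frequencies, and with probability at least $1-\rho$ on the joint drawing of the items $x_i$ and the frequencies $\omega_j$, every $\bar P\in\operatorname{argmin}_{P\in\Sigma}\|\hat z-\mathcal A P\|_2$ satisfies $$\gamma_\Lambda(P^*,\bar P)\ \le\ 5\,d_{TV}(P^*,\Sigma)+\frac{4\big(1+\sqrt{2\log(2/\rho)}\big)}{\sqrt n}+\eta .$$ (For $\rho\ge1$ the probability statement is trivial.) -/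

import Mathlib

open MeasureTheory ProbabilityTheory

noncomputable section

namespace SketchedGMM

/-- The total variation norm `‖ν‖_TV = |ν|(X)` of a finite signed measure, where
`|ν| = ν⁺ + ν⁻` for the Jordan decomposition of `ν` (so it takes values in `[0, 2]` on
differences of probability measures). -/
def tvNorm {X : Type*} [MeasurableSpace X] (ν : SignedMeasure X) : ℝ :=
  (ν.totalVariation Set.univ).toReal

/-- `‖P - Q‖_TV` for probability measures. -/
def tvDist {X : Type*} [MeasurableSpace X] (P Q : ProbabilityMeasure X) : ℝ :=
  tvNorm ((P : Measure X).toSignedMeasure - (Q : Measure X).toSignedMeasure)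

/-- `d_TV(P, Σ) = inf_{Q ∈ Σ} ‖P - Q‖_TV`. -/
def tvDistToModel {X : Type*} [MeasurableSpace X] (P : ProbabilityMeasure X)
    (model : Set (ProbabilityMeasure X)) : ℝ :=
  sInf ((fun Q => tvDist P Q) '' model)

/-- The data (and frequency) space `ℝ^d` with its Euclidean structure. -/
abbrev Space (d : ℕ) : Type := EuclideanSpace ℝ (Fin d)

/-- The parameter space `ℝ^{2d}` with its Euclidean norm: the coordinates indexed by
`Sum.inl ℓ` form the mean, those indexed by `Sum.inr ℓ` are the variances `σ_ℓ²`. -/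
abbrev Param (d : ℕ) : Type := EuclideanSpace ℝ (Fin d ⊕ Fin d)

/-- The mean `μ` of the parameter `θ = [μ, σ]`. -/
def Param.mean {d : ℕ} (θ : Param d) : Space d := WithLp.toLp 2 fun l => θ (Sum.inl l)

/-- The `l`-th variance `σ_l²` of the parameter `θ = [μ, σ]`. -/
def Param.variance {d : ℕ} (θ : Param d) (l : Fin d) : ℝ := θ (Sum.inr l)

/-- The Gaussian `P_θ` with mean `μ` and diagonal covariance `diag(σ_1², …, σ_d²)`. -/
def gaussian {d : ℕ} (θ : Param d) : Measure (Space d) :=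
  multivariateGaussian θ.mean (Matrix.diagonal θ.variance)

/-- The set of `K`-component Gaussian mixtures `∑ k, α_k P_{θ_k}` with all `θ_k ∈ T`,
`α_k ≥ 0` and `∑ k, α_k = 1`. -/
def gmm {d : ℕ} (K : ℕ) (T : Set (Param d)) : Set (ProbabilityMeasure (Space d)) :=
  {P | ∃ (θ : Fin K → Param d) (α : Fin K → NNReal),
    (∀ k, θ k ∈ T) ∧ ∑ k, α k = 1 ∧ (P : Measure (Space d)) = ∑ k, α k • gaussian (θ k)}

/-- The characteristic function `ψ_P(ω) = ∫ exp(-i ωᵀx) dP(x)`. -/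
def charFn {d : ℕ} (P : Measure (Space d)) (ω : Space d) : ℂ :=
  ∫ x, Complex.exp (-Complex.I * ((inner ℝ ω x : ℝ) : ℂ)) ∂P

/-- The sketching operator `P ↦ m^{-1/2} [ψ_P(ω_1), …, ψ_P(ω_m)]`. -/
def sketch {d m : ℕ} (ω : Fin m → Space d) (P : Measure (Space d)) :
    EuclideanSpace ℂ (Fin m) :=
  WithLp.toLp 2 fun j => ((1 / Real.sqrt m : ℝ) : ℂ) * charFn P (ω j)

/-- The empirical distribution `(1/n) ∑ i, δ_{x_i}`. -/
def empirical {d n : ℕ} (x : Fin n → Space d) : Measure (Space d) :=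
  (n : ENNReal)⁻¹ • ∑ i, Measure.dirac (x i)

/-- The maximum mean discrepancy
`γ_Λ(P, Q) = (∫ |ψ_P(ω) - ψ_Q(ω)|² dΛ(ω))^{1/2}`. -/
def mmd {d : ℕ} (Λ : Measure (Space d)) (P Q : ProbabilityMeasure (Space d)) : ℝ :=
  Real.sqrt (∫ ω, ‖charFn (P : Measure (Space d)) ω - charFn (Q : Measure (Space d)) ω‖ ^ 2 ∂Λ)

/-- The set `argmin_{P ∈ Σ} ‖z - A P‖₂` of possible outputs of the ideal decoder, given the
sketch `z` and the frequencies `ω` that define the sketching operator `A`. -/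
def decoderSet {d m : ℕ} (model : Set (ProbabilityMeasure (Space d)))
    (z : EuclideanSpace ℂ (Fin m)) (ω : Fin m → Space d) : Set (ProbabilityMeasure (Space d)) :=
  {P | P ∈ model ∧ ∀ Q ∈ model,
    ‖z - sketch ω (P : Measure (Space d))‖ ≤ ‖z - sketch ω (Q : Measure (Space d))‖}

/-- `σ_min²`: the least variance that occurs in the parameter set. -/
def minVariance {d : ℕ} (T : Set (Param d)) : ℝ :=
  sInf {v : ℝ | ∃ θ ∈ T, ∃ l : Fin d, v = θ.variance l}

/-- The Chebyshev radius: the infimum of the radii `r > 0` of the closed Euclidean balls that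
contain `T`. -/
def chebyshevRadius {d : ℕ} (T : Set (Param d)) : ℝ :=
  sInf {r : ℝ | 0 < r ∧ ∃ c : Param d, T ⊆ Metric.closedBall c r}

/-- `B = 8 max(σ_min⁻¹, σ_min⁻² / √2) rad(T)`. -/
def constB {d : ℕ} (T : Set (Param d)) : ℝ :=
  8 * max (Real.sqrt (minVariance T))⁻¹ ((minVariance T)⁻¹ / Real.sqrt 2) * chebyshevRadius T

/-- `C = √(48 (B + 1))`. -/
def constC {d : ℕ} (T : Set (Param d)) : ℝ :=
  Real.sqrt (48 * (constB T + 1))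

end SketchedGMM

end

open SketchedGMM

/-! Fix once and for all a mixture `P₀` in the model that is nearly closest to `P*` in total
variation. Functions bounded by one integrate with error at most the total variation, so replacing
`P*` by `P₀` costs at most that distance, both in the MMD and in the sketch. It remains to bound the
MMD between `P̄` and `P₀` by the distance of their sketches.

For a fixed pair, the squared sketch distance is an empirical mean over the frequencies of variables
in [0, 4] with mean γ². A multiplicative Chernoff bound (`measureReal_pi_sum_le_quarter_le`) makes
it exceed γ²/4 except with probability exp(-mγ²/12). Only pairs with γ > η/2 matter, which gives
exp(-mη²/48): the exponent is linear in the mean, hence η⁻² and not η⁻⁴ in the condition on `m`. As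
`P₀` is fixed, a union bound over a net of the model, rather than of pairs, suffices.

The net (`exists_finset_net_gmm_card_le`) comes from volume bounds in parameter space. Gaussian
characteristic functions are Lipschitz in the parameter, uniformly in the frequency, because
Gaussian decay absorbs the powers of |ω|. Errors uniform in ω transfer to the MMD and to every
sketch.

For fixed frequencies, the sketch of the data has mean error at most 1/√n, and McDiarmid's
inequality controls the fluctuation. The decoder's optimality and triangle inequalities combine
these facts (`mmd_le_of_mem_decoderSet`). -/

/-! ### Nets from volume comparison -/

open Module in
/-- Volume bound for separated subsets of a ball. -/
theorem Finset.card_le_of_separated_of_subset_closedBall {E : Type*} [NormedAddCommGroup E]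
    [NormedSpace ℝ E] [FiniteDimensional ℝ E] {s : Finset E} {c : E} {r ε : ℝ} (hε : 0 < ε)
    (hr : 0 ≤ r) (hs : (s : Set E) ⊆ Metric.closedBall c r)
    (hsep : (s : Set E).Pairwise fun x y => ε ≤ dist x y) :
    (s.card : ℝ) ≤ (1 + 2 * r / ε) ^ finrank ℝ E := by
  borelize E
  let μ : Measure E := Measure.addHaar
  have hdisj : (s : Set E).PairwiseDisjoint fun x => Metric.ball x (ε / 2) := by
    intro x hx y hy hxy
    exact Metric.ball_disjoint_ball (by linarith [hsep hx hy hxy])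
  have hsub : (⋃ x ∈ s, Metric.ball x (ε / 2)) ⊆ Metric.ball c (r + ε / 2) := by
    refine Set.iUnion₂_subset fun x hx y hy => ?_
    have h1 : dist x c ≤ r := hs hx
    have h2 : dist y x < ε / 2 := hy
    have := dist_triangle y x c
    simp only [Metric.mem_ball]
    linarith
  have hvol := measure_mono (μ := μ) hsub
  rw [measure_biUnion_finset hdisj (fun _ _ => Metric.isOpen_ball.measurableSet)] at hvol
  simp only [Measure.addHaar_ball_of_pos μ _ (half_pos hε),
    Measure.addHaar_ball_of_pos μ _ (by positivity : 0 < r + ε / 2), Finset.sum_const,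
    nsmul_eq_mul, ← mul_assoc] at hvol
  have h0 : μ (Metric.ball 0 1) ≠ 0 := (Metric.measure_ball_pos μ _ one_pos).ne'
  rw [ENNReal.mul_le_mul_iff_left h0 measure_ball_lt_top.ne, ← ENNReal.ofReal_natCast,
    ← ENNReal.ofReal_mul (by positivity), ENNReal.ofReal_le_ofReal_iff (by positivity),
    ← le_div_iff₀ (by positivity), ← div_pow] at hvol
  refine hvol.trans_eq (congrArg (· ^ finrank ℝ E) ?_)
  field_simp
  ring

open Module in
/-- A subset of a ball of radius `r` has an internal `ε`-net with at most `(1 + 2 r / ε) ^ dim`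
points. -/
theorem exists_finset_net_of_subset_closedBall {E : Type*} [NormedAddCommGroup E]
    [NormedSpace ℝ E] [FiniteDimensional ℝ E] {A : Set E} {c : E} {r ε : ℝ} (hε : 0 < ε)
    (hr : 0 ≤ r) (hA : A ⊆ Metric.closedBall c r) :
    ∃ s : Finset E, (s : Set E) ⊆ A ∧ (s.card : ℝ) ≤ (1 + 2 * r / ε) ^ finrank ℝ E ∧
      ∀ x ∈ A, ∃ y ∈ s, dist x y ≤ ε := by
  classical
  -- The volume bound caps the size of separated subsets, so one of largest size exists; a point far
  -- from all its elements could be added to it, so it is a net.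
  let p : ℕ → Prop := fun k => ∃ s : Finset E, (s : Set E) ⊆ A ∧
    (s : Set E).Pairwise (fun x y => ε ≤ dist x y) ∧ s.card = k
  have hp : ∀ k, p k → k ≤ ⌊(1 + 2 * r / ε) ^ finrank ℝ E⌋₊ := by
    rintro k ⟨s, hsA, hs, rfl⟩
    exact Nat.le_floor (Finset.card_le_of_separated_of_subset_closedBall hε hr (hsA.trans hA) hs)
  have hp0 : p 0 := ⟨∅, by simp, by simp, rfl⟩
  obtain ⟨s, hsA, hs, hcard⟩ := Nat.findGreatest_spec (P := p)
    (Nat.zero_le ⌊(1 + 2 * r / ε) ^ finrank ℝ E⌋₊) hp0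
  refine ⟨s, hsA, Finset.card_le_of_separated_of_subset_closedBall hε hr (hsA.trans hA) hs,
    fun x hx => ?_⟩
  by_contra! hcon
  have hxs : x ∉ s := fun h => by simpa using (hcon x h).trans' hε
  have hp' : p (s.card + 1) := by
    refine ⟨insert x s, ?_, ?_, Finset.card_insert_of_notMem hxs⟩
    · simpa [Set.insert_subset_iff] using ⟨hx, hsA⟩
    · rw [Finset.coe_insert]
      exact hs.insert fun y hy _ => ⟨(hcon y hy).le, dist_comm x y ▸ (hcon y hy).le⟩
  have := Nat.le_findGreatest (hp _ hp') hp'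
  omega

/-! ### Concentration inequalities -/

/-- Hoeffding's lemma for a function whose oscillation is at most `c`. -/
theorem integral_exp_mul_sub_integral_le {X : Type*} [MeasurableSpace X] {P : Measure X}
    [IsProbabilityMeasure P] {h : X → ℝ} (hm : Measurable h) {c : ℝ}
    (hc : ∀ x y, |h x - h y| ≤ c) (s : ℝ) :
    ∫ x, Real.exp (s * (h x - ∫ y, h y ∂P)) ∂P ≤ Real.exp (s ^ 2 * c ^ 2 / 8) := by
  have : Nonempty X := nonempty_of_isProbabilityMeasure P
  obtain ⟨x₀⟩ := this
  have hc0 : 0 ≤ c := (abs_nonneg _).trans (hc x₀ x₀)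
  have hbdd : BddBelow (Set.range h) := by
    refine ⟨h x₀ - c, ?_⟩
    rintro _ ⟨x, rfl⟩
    linarith [abs_le.1 (hc x₀ x)]
  -- Oscillation at most `c` places the values in an interval of length `c` starting at the infimum,
  -- as the interval form of Hoeffding's lemma requires.
  have hIcc : ∀ x, h x ∈ Set.Icc (⨅ y, h y) ((⨅ y, h y) + c) := by
    have : Nonempty X := ⟨x₀⟩
    refine fun x => ⟨ciInf_le hbdd x, ?_⟩
    have : h x - c ≤ ⨅ y, h y := le_ciInf fun y => by linarith [abs_le.1 (hc x y)]
    linarith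
  have hsub := hasSubgaussianMGF_of_mem_Icc (μ := P) hm.aemeasurable (Filter.Eventually.of_forall hIcc)
  have := hsub.mgf_le s
  rw [mgf] at this
  refine this.trans (Real.exp_le_exp.2 (le_of_eq ?_))
  simp only [add_sub_cancel_left, NNReal.coe_pow, NNReal.coe_div, coe_nnnorm, Real.norm_eq_abs,
    abs_of_nonneg hc0]
  push_cast
  ring

/-- The moment generating function bound behind McDiarmid's inequality. -/
theorem integral_pi_exp_mul_sub_integral_le {X : Type*} [MeasurableSpace X] {P : Measure X}
    [IsProbabilityMeasure P] {c : ℝ} (s : ℝ) (n : ℕ) (f : (Fin n → X) → ℝ) (hm : Measurable f)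
    {M : ℝ} (hM : ∀ x, |f x| ≤ M)
    (hc : ∀ x i y, |f x - f (Function.update x i y)| ≤ c) :
    ∫ x, Real.exp (s * (f x - ∫ y, f y ∂(Measure.pi fun _ => P))) ∂(Measure.pi fun _ => P) ≤
      Real.exp (n * (s ^ 2 * c ^ 2 / 8)) := by
  induction n with
  | zero =>
    have hf : ∀ x, f x = f default := fun x => congrArg f (Subsingleton.elim _ _)
    simp_rw [hf]
    simp
  | succ n ih =>
    let e := MeasurableEquiv.piFinSuccAbove (fun _ : Fin (n + 1) => X) 0
    have he := (measurePreserving_piFinSuccAbove (fun _ : Fin (n + 1) => P) 0).symm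
    have hes : ∀ z : X × (Fin n → X), e.symm z = Fin.cons z.1 z.2 := fun z => by
      simp [e, MeasurableEquiv.piFinSuccAbove, Fin.consEquiv]
    have hint : ∀ F : (Fin (n + 1) → X) → ℝ, Integrable F (Measure.pi fun _ => P) →
        ∫ x, F x ∂(Measure.pi fun _ => P) =
          ∫ x', ∫ x₀, F (Fin.cons x₀ x') ∂P ∂(Measure.pi fun _ : Fin n => P) := by
      intro F hF
      rw [← he.integral_comp' (g := F)]
      have hF' := (he.integrable_comp_emb e.symm.measurableEmbedding).2 hF
      refine (integral_prod_symm _ hF').trans ?_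
      exact integral_congr_ae (.of_forall fun x' => integral_congr_ae (.of_forall fun x₀ => by
        exact congrArg F (hes (x₀, x'))))
    have hcons : Measurable fun z : X × (Fin n → X) => (Fin.cons z.1 z.2 : Fin (n + 1) → X) := by
      convert e.symm.measurable using 2 with z
      exact (hes z).symm
    -- Averaging out coordinate 0 preserves the mean and the bounded differences. For fixed
    -- remaining coordinates, `f - g` is centred with oscillation at most `c`, so each coordinate
    -- contributes one Hoeffding factor.
    let g : (Fin n → X) → ℝ := fun x' => ∫ x₀, f (Fin.cons x₀ x') ∂P
    have hfx : ∀ x', Measurable fun x₀ => f (Fin.cons x₀ x') := fun x' =>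
      hm.comp (hcons.comp measurable_prodMk_right)
    have hfi : ∀ x', Integrable (fun x₀ => f (Fin.cons x₀ x')) P := fun x' =>
      Integrable.of_bound (hfx x').aestronglyMeasurable M (.of_forall fun _ => hM _)
    have hg : Measurable g := by
      have : StronglyMeasurable fun z : (Fin n → X) × X => f (Fin.cons z.2 z.1) :=
        (hm.comp (hcons.comp measurable_swap)).stronglyMeasurable
      exact this.integral_prod_right'.measurable
    have hgM : ∀ x', |g x'| ≤ M := fun x' => by
      simpa using norm_integral_le_of_norm_le_const (μ := P) (f := fun x₀ => f (Fin.cons x₀ x'))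
        (.of_forall fun _ => hM _)
    have hgc : ∀ x i y, |g x - g (Function.update x i y)| ≤ c := fun x i y => by
      simp only [g]
      rw [← integral_sub (hfi _) (hfi _)]
      have := norm_integral_le_of_norm_le_const (μ := P) (C := c)
        (f := fun x₀ => f (Fin.cons x₀ x) - f (Fin.cons x₀ (Function.update x i y)))
        (.of_forall fun x₀ => by
          have := hc (Fin.cons x₀ x) i.succ y
          rwa [Fin.cons_update] )
      simpa using this
    have hmean : ∫ y, f y ∂(Measure.pi fun _ => P) = ∫ y, g y ∂(Measure.pi fun _ => P) :=
      hint f (Integrable.of_bound hm.aestronglyMeasurable M (.of_forall fun _ => hM _))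
    set a := ∫ y, f y ∂(Measure.pi fun _ => P) with ha
    have hexpi : ∀ {k : ℕ} (h : (Fin k → X) → ℝ) (b : ℝ), Measurable h → (∀ x, |h x| ≤ M) →
        Integrable (fun x => Real.exp (s * (h x - b))) (Measure.pi fun _ => P) := by
      intro k h b hh hhM
      refine Integrable.of_bound (by fun_prop) (Real.exp (|s| * (M + |b|)))
        (.of_forall fun x => ?_)
      rw [Real.norm_eq_abs, Real.abs_exp, Real.exp_le_exp]
      refine (le_abs_self _).trans ?_
      rw [abs_mul]
      exact mul_le_mul_of_nonneg_left ((abs_sub _ _).trans (by linarith [hhM x])) (abs_nonneg _)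
    rw [hint _ (hexpi f a hm hM)]
    have hinner : ∀ x', ∫ x₀, Real.exp (s * (f (Fin.cons x₀ x') - a)) ∂P ≤
        Real.exp (s ^ 2 * c ^ 2 / 8) * Real.exp (s * (g x' - a)) := by
      intro x'
      have : ∀ x₀, Real.exp (s * (f (Fin.cons x₀ x') - a)) =
          Real.exp (s * (f (Fin.cons x₀ x') - g x')) * Real.exp (s * (g x' - a)) := fun x₀ => by
        rw [← Real.exp_add]; ring_nf
      simp_rw [this, integral_mul_const]
      refine mul_le_mul_of_nonneg_right ?_ (Real.exp_pos _).le
      refine integral_exp_mul_sub_integral_le (hfx x') (fun x y => ?_) s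
      have := hc (Fin.cons x x') 0 y
      rwa [Fin.update_cons_zero] at this
    have hi := (hexpi g a hg hgM).const_mul (Real.exp (s ^ 2 * c ^ 2 / 8))
    refine (integral_mono_of_nonneg (.of_forall fun x' => integral_nonneg fun _ =>
      (Real.exp_pos _).le) hi (.of_forall hinner)).trans ?_
    rw [integral_const_mul, hmean]
    refine (mul_le_mul_of_nonneg_left (ih g hg hgM hgc) (Real.exp_pos _).le).trans ?_
    rw [← Real.exp_add, Real.exp_le_exp]
    push_cast
    linarith

/-- **McDiarmid's inequality** with equal bounds on the differences. -/
theorem measureReal_pi_ge_le_of_bounded_differences {X : Type*} [MeasurableSpace X]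
    {P : Measure X} [IsProbabilityMeasure P] {c t : ℝ} {n : ℕ} (hn : 0 < n) (hc0 : 0 < c)
    (ht : 0 ≤ t) (f : (Fin n → X) → ℝ) (hm : Measurable f) {M : ℝ} (hM : ∀ x, |f x| ≤ M)
    (hc : ∀ x i y, |f x - f (Function.update x i y)| ≤ c) :
    (Measure.pi fun _ : Fin n => P).real {x | ∫ y, f y ∂(Measure.pi fun _ => P) + t ≤ f x} ≤
      Real.exp (-2 * t ^ 2 / (n * c ^ 2)) := by
  have hn' : (0 : ℝ) < n := by exact_mod_cast hn
  set a := ∫ y, f y ∂(Measure.pi fun _ : Fin n => P) with ha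
  -- The minimiser of the Chernoff exponent -st + ns²c²/8.
  let s : ℝ := 4 * t / (n * c ^ 2)
  have hs : 0 ≤ s := by positivity
  have hi : Integrable (fun x => Real.exp (s * (f x - a))) (Measure.pi fun _ : Fin n => P) := by
    refine Integrable.of_bound (by fun_prop) (Real.exp (|s| * (M + |a|)))
      (.of_forall fun x => ?_)
    rw [Real.norm_eq_abs, Real.abs_exp, Real.exp_le_exp]
    refine (le_abs_self _).trans ?_
    rw [abs_mul]
    exact mul_le_mul_of_nonneg_left ((abs_sub _ _).trans (by linarith [hM x])) (abs_nonneg _)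
  have h := measure_ge_le_exp_mul_mgf (μ := Measure.pi fun _ : Fin n => P)
    (X := fun x => f x - a) t hs hi
  have hset : {x | a + t ≤ f x} = {x | t ≤ f x - a} := by
    ext x; simp only [Set.mem_ofPred_eq]; constructor <;> intro h <;> linarith
  rw [hset]
  refine h.trans ?_
  have h2 := integral_pi_exp_mul_sub_integral_le (P := P) s n f hm hM hc
  rw [mgf]
  refine (mul_le_mul_of_nonneg_left h2 (Real.exp_pos _).le).trans ?_
  rw [← Real.exp_add, Real.exp_le_exp]
  refine le_of_eq ?_
  simp only [s]
  field_simp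
  ring

/-- A Chernoff bound for the lower tail of a sum of independent `[0, 4]`-valued variables. -/
theorem measureReal_pi_sum_le_quarter_le {X : Type*} [MeasurableSpace X] {P : Measure X}
    [IsProbabilityMeasure P] {m : ℕ} {f : X → ℝ} (hm : Measurable f) (h0 : ∀ x, 0 ≤ f x)
    (h4 : ∀ x, f x ≤ 4) :
    (Measure.pi fun _ : Fin m => P).real {x | ∑ j, f (x j) ≤ m * ((∫ y, f y ∂P) / 4)} ≤
      Real.exp (-(m * (∫ y, f y ∂P) / 12)) := by
  set g := ∫ y, f y ∂P with hg
  have hg0 : 0 ≤ g := integral_nonneg h0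
  have hi : Integrable f P := Integrable.of_bound hm.aestronglyMeasurable 4
    (.of_forall fun x => by rw [Real.norm_eq_abs, abs_of_nonneg (h0 x)]; exact h4 x)
  -- The chord of exp(-y/4) over [0, 4] has slope (e⁻¹ - 1)/4 ≤ -7/48. With parameter 1/4 and
  -- threshold mg/4 the exponent is then mg(3/48 - 7/48) = -mg/12.
  have he : Real.exp (-1) ≤ 5 / 12 := by
    rw [Real.exp_neg, inv_le_comm₀ (Real.exp_pos _) (by norm_num)]
    linarith [Real.exp_one_gt_d9]
  have hchord : ∀ x, Real.exp (-(1 / 4) * f x) ≤ 1 - 7 / 48 * f x := by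
    intro x
    have := convexOn_exp.2 (Set.mem_univ (-1 : ℝ)) (Set.mem_univ 0)
      (by linarith [h0 x] : 0 ≤ f x / 4) (by linarith [h4 x] : 0 ≤ 1 - f x / 4) (by ring)
    simp only [smul_eq_mul, mul_zero, add_zero, Real.exp_zero, mul_one] at this
    rw [show -(1 / 4) * f x = f x / 4 * -1 by ring]
    nlinarith [h0 x]
  have hexpi : Integrable (fun x => Real.exp (-(1 / 4) * f x)) P :=
    Integrable.of_bound (by fun_prop) 1 (.of_forall fun x => by
      rw [Real.norm_eq_abs, Real.abs_exp, Real.exp_le_one_iff]; linarith [h0 x])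
  have hmgf : ∫ x, Real.exp (-(1 / 4) * f x) ∂P ≤ Real.exp (-(7 / 48) * g) := by
    calc _ ≤ ∫ x, (1 - 7 / 48 * f x) ∂P :=
          integral_mono hexpi ((integrable_const _).sub (hi.const_mul _)) hchord
      _ = 1 - 7 / 48 * g := by
          rw [integral_sub (integrable_const _) (hi.const_mul _), integral_const_mul]; simp [hg]
      _ ≤ _ := by linarith [Real.add_one_le_exp (-(7 / 48) * g)]
  have hprod : ∀ x : Fin m → X, Real.exp (-(1 / 4) * ∑ j, f (x j)) =
      ∏ j, Real.exp (-(1 / 4) * f (x j)) := fun x => by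
    rw [← Real.exp_sum, Finset.mul_sum]
  have hsi : Integrable (fun x : Fin m → X => Real.exp (-(1 / 4) * ∑ j, f (x j)))
      (Measure.pi fun _ => P) :=
    Integrable.of_bound (Measurable.aestronglyMeasurable (by fun_prop)) 1 (.of_forall fun x => by
      rw [Real.norm_eq_abs, Real.abs_exp, Real.exp_le_one_iff]
      linarith [Finset.sum_nonneg fun j (_ : j ∈ Finset.univ) => h0 (x j)])
  have h := measure_le_le_exp_mul_mgf (μ := Measure.pi fun _ : Fin m => P)
    (X := fun x => ∑ j, f (x j)) (m * (g / 4)) (by norm_num : (-(1 / 4) : ℝ) ≤ 0) hsi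
  refine h.trans ?_
  rw [mgf]
  simp_rw [hprod]
  rw [integral_fintype_prod_eq_prod (μ := fun _ : Fin m => P)
    (f := fun _ x => Real.exp (-(1 / 4) * f x))]
  simp only [Finset.prod_const, Finset.card_univ, Fintype.card_fin]
  have hpow : (∫ x, Real.exp (-(1 / 4) * f x) ∂P) ^ m ≤ Real.exp (m * (-(7 / 48) * g)) := by
    rw [Real.exp_nat_mul]
    exact pow_le_pow_left₀ (integral_nonneg fun _ => (Real.exp_pos _).le) hmgf m
  refine (mul_le_mul_of_nonneg_left hpow (Real.exp_pos _).le).trans ?_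
  rw [← Real.exp_add, Real.exp_le_exp]
  exact le_of_eq (by ring)

/-! ### Analytic estimates: exponential, total variation, second moments -/

/-- The complex exponential is `exp c`-Lipschitz on the half-plane `re z ≤ c`. -/
theorem Complex.norm_exp_sub_exp_le {z w : ℂ} {c : ℝ} (hz : z.re ≤ c) (hw : w.re ≤ c) :
    ‖Complex.exp z - Complex.exp w‖ ≤ Real.exp c * ‖z - w‖ := by
  refine Convex.norm_image_sub_le_of_norm_deriv_le (s := {u : ℂ | u.re ≤ c})
    (fun x _ => Complex.differentiableAt_exp) (fun x hx => ?_) (convex_halfSpace_re_le c) hw hz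
  rw [Complex.deriv_exp, Complex.norm_exp]
  exact Real.exp_le_exp.2 hx

/-- Integrals of a function bounded by one against two measures differ by at most the total
variation of the difference of the measures. -/
theorem norm_integral_sub_integral_le_tvDist {X : Type*} [MeasurableSpace X]
    (P Q : ProbabilityMeasure X) {f : X → ℂ} (hf : Measurable f) (h1 : ∀ x, ‖f x‖ ≤ 1) :
    ‖∫ x, f x ∂(P : Measure X) - ∫ x, f x ∂(Q : Measure X)‖ ≤ tvDist P Q := by
  set ν := (P : Measure X).toSignedMeasure - (Q : Measure X).toSignedMeasure with hν
  set j := ν.toJordanDecomposition with hj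
  have hint : ∀ (κ : Measure X) [IsFiniteMeasure κ], Integrable f κ := fun κ _ =>
    Integrable.of_bound hf.aestronglyMeasurable 1 (.of_forall h1)
  -- The Jordan decomposition, rearranged as an identity between positive measures so that it can be
  -- integrated.
  have hmeas : (P : Measure X) + j.negPart = Q + j.posPart := by
    apply Measure.toSignedMeasure_eq_toSignedMeasure_iff.1
    have h := ν.toSignedMeasure_toJordanDecomposition
    rw [JordanDecomposition.toSignedMeasure] at h
    rw [Measure.toSignedMeasure_add, Measure.toSignedMeasure_add]
    have : j.posPart.toSignedMeasure = ν + j.negPart.toSignedMeasure := by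
      rw [← h, hj, sub_add_cancel]
    rw [this, hν]
    abel
  have heq : ∫ x, f x ∂(P : Measure X) - ∫ x, f x ∂(Q : Measure X) =
      ∫ x, f x ∂j.posPart - ∫ x, f x ∂j.negPart := by
    have : ∫ x, f x ∂(P + j.negPart : Measure X) = ∫ x, f x ∂(Q + j.posPart : Measure X) := by
      rw [hmeas]
    rw [integral_add_measure (hint _) (hint _), integral_add_measure (hint _) (hint _)] at this
    linear_combination this
  have hle : ∀ (κ : Measure X) [IsFiniteMeasure κ], ‖∫ x, f x ∂κ‖ ≤ κ.real Set.univ :=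
    fun κ _ => by simpa using norm_integral_le_of_norm_le_const (μ := κ) (C := 1) (.of_forall h1)
  rw [heq, tvDist, tvNorm, ← hν, SignedMeasure.totalVariation, ← hj, Measure.add_apply,
    ENNReal.toReal_add (measure_ne_top _ _) (measure_ne_top _ _)]
  exact (norm_sub_le _ _).trans (add_le_add (hle _) (hle _))

theorem sq_integral_le_integral_sq {X : Type*} [MeasurableSpace X] {P : Measure X}
    [IsProbabilityMeasure P] {f : X → ℝ} (hf : MemLp f 2 P) :
    (∫ x, f x ∂P) ^ 2 ≤ ∫ x, f x ^ 2 ∂P := by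
  have h := variance_nonneg f P
  rw [variance_eq_sub hf] at h
  simpa using h

/-! ### Characteristic functions, sketches and the MMD -/

namespace SketchedGMM

variable {d : ℕ}

theorem charFn_eq_charFun (P : Measure (Space d)) (ω : Space d) :
    charFn P ω = charFun P (-ω) := by
  rw [charFn, charFun_apply]
  refine integral_congr_ae (.of_forall fun x => ?_)
  simp only [inner_neg_right, real_inner_comm]
  push_cast
  ring_nf

theorem measurable_charFn (P : Measure (Space d)) [IsFiniteMeasure P] :
    Measurable (charFn P) := by
  rw [funext (charFn_eq_charFun P)]
  exact measurable_charFun.comp measurable_neg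

theorem norm_charFn_le_one (P : Measure (Space d)) [IsProbabilityMeasure P] (ω : Space d) :
    ‖charFn P ω‖ ≤ 1 := by
  rw [charFn_eq_charFun]
  exact norm_charFun_le_one _

theorem norm_exp_neg_I_mul (a : ℝ) : ‖Complex.exp (-Complex.I * (a : ℂ))‖ = 1 := by
  have := Complex.norm_exp_ofReal_mul_I (-a)
  rw [← this]; push_cast; ring_nf

theorem measurable_exp_neg_I_mul_inner (ω : Space d) :
    Measurable fun x : Space d => Complex.exp (-Complex.I * ((inner ℝ ω x : ℝ) : ℂ)) := by
  fun_prop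

theorem integrable_exp_neg_I_mul_inner (P : Measure (Space d)) [IsFiniteMeasure P]
    (ω : Space d) :
    Integrable (fun x : Space d => Complex.exp (-Complex.I * ((inner ℝ ω x : ℝ) : ℂ))) P :=
  Integrable.of_bound (measurable_exp_neg_I_mul_inner ω).aestronglyMeasurable 1
    (.of_forall fun _ => (norm_exp_neg_I_mul _).le)

theorem norm_charFn_sub_le_tvDist (P Q : ProbabilityMeasure (Space d)) (ω : Space d) :
    ‖charFn (P : Measure (Space d)) ω - charFn (Q : Measure (Space d)) ω‖ ≤ tvDist P Q :=
  norm_integral_sub_integral_le_tvDist P Q (measurable_exp_neg_I_mul_inner ω)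
    fun _ => (norm_exp_neg_I_mul _).le

theorem charFn_gaussian {θ : Param d} (hθ : ∀ l, 0 ≤ θ.variance l) (ω : Space d) :
    charFn (gaussian θ) ω =
      Complex.exp (⟨-(∑ l, θ (Sum.inr l) * ω l ^ 2) / 2, -∑ l, θ (Sum.inl l) * ω l⟩ : ℂ) := by
  rw [charFn_eq_charFun, gaussian, charFun_multivariateGaussian
    (Matrix.PosSemidef.diagonal hθ)]
  congr 1
  apply Complex.ext
  · simp [dotProduct, Matrix.mulVec_diagonal, Param.variance]
    rw [neg_div]
    refine congrArg (fun u => -(u / 2)) (Finset.sum_congr rfl fun l _ => by ring)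
  · simp [dotProduct, Matrix.mulVec_diagonal, Param.mean, PiLp.inner_apply]

/-- The Gaussian characteristic functions are Lipschitz in the parameter, uniformly in the
frequency, as long as the variances are bounded below. -/
theorem norm_charFn_gaussian_sub_le {θ θ' : Param d} {v : ℝ} (hv : 0 < v)
    (hθ : ∀ l, v ≤ θ.variance l) (hθ' : ∀ l, v ≤ θ'.variance l) (ω : Space d) :
    ‖charFn (gaussian θ) ω - charFn (gaussian θ') ω‖ ≤
      max (Real.sqrt v)⁻¹ (v⁻¹ / Real.sqrt 2) * dist θ θ' := by
  rw [charFn_gaussian (fun l => hv.le.trans (hθ l)), charFn_gaussian (fun l => hv.le.trans (hθ' l))]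
  set S := ∑ l, ω l ^ 2 with hS
  set M := max (Real.sqrt v)⁻¹ (v⁻¹ / Real.sqrt 2) with hM
  have hS0 : 0 ≤ S := Finset.sum_nonneg fun _ _ => sq_nonneg _
  have hM1 : v⁻¹ ≤ M ^ 2 := by
    have h : (Real.sqrt v)⁻¹ ≤ M := le_max_left _ _
    have := pow_le_pow_left₀ (by positivity) h 2
    rwa [inv_pow, Real.sq_sqrt hv.le] at this
  have hM2 : v⁻¹ ^ 2 / 2 ≤ M ^ 2 := by
    have h : v⁻¹ / Real.sqrt 2 ≤ M := le_max_right _ _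
    have := pow_le_pow_left₀ (by positivity) h 2
    rwa [div_pow, Real.sq_sqrt (by norm_num)] at this
  have hM0 : 0 ≤ M := le_max_of_le_left (by positivity)
  have hre : ∀ κ : Param d, (∀ l, v ≤ κ.variance l) →
      -(∑ l, κ (Sum.inr l) * ω l ^ 2) / 2 ≤ -(v * S) / 2 := by
    intro κ hκ
    have : v * S ≤ ∑ l, κ (Sum.inr l) * ω l ^ 2 := by
      rw [hS, Finset.mul_sum]
      exact Finset.sum_le_sum fun l _ => mul_le_mul_of_nonneg_right (hκ l) (sq_nonneg _)
    linarith
  -- Both exponents have real part at most -vS/2, so the exponential contributes the decay factor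
  -- exp(-vS/2).
  refine (Complex.norm_exp_sub_exp_le (hre θ hθ) (hre θ' hθ')).trans ?_
  have ht0 : 0 ≤ v * S := by positivity
  -- With t = vS, the bounds t ≤ eᵗ and t²/2 ≤ eᵗ give e⁻ᵗS ≤ v⁻¹ for the means and e⁻ᵗS²/4 ≤ v⁻²/2
  -- for the variances: the squares of the two entries of the maximum.
  have hexp := Real.quadratic_le_exp_of_nonneg ht0
  have hE1 : Real.exp (-(v * S)) * S ≤ M ^ 2 := by
    refine le_trans ?_ hM1
    rw [Real.exp_neg, inv_mul_le_iff₀ (Real.exp_pos _), ← div_eq_mul_inv, le_div_iff₀ hv]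
    nlinarith
  have hE2 : Real.exp (-(v * S)) * (S ^ 2 / 4) ≤ M ^ 2 := by
    refine le_trans ?_ hM2
    rw [Real.exp_neg, inv_mul_le_iff₀ (Real.exp_pos _)]
    have : S ^ 2 / 4 = (v * S) ^ 2 / 2 * (v⁻¹ ^ 2 / 2) := by field_simp; ring
    rw [this]
    exact mul_le_mul_of_nonneg_right (by linarith) (by positivity)
  set a := ∑ l, (θ (Sum.inl l) - θ' (Sum.inl l)) ^ 2 with ha
  set b := ∑ l, (θ (Sum.inr l) - θ' (Sum.inr l)) ^ 2 with hb
  have ha0 : 0 ≤ a := Finset.sum_nonneg fun _ _ => sq_nonneg _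
  have hb0 : 0 ≤ b := Finset.sum_nonneg fun _ _ => sq_nonneg _
  have hdist : dist θ θ' ^ 2 = a + b := by
    rw [EuclideanSpace.dist_eq, Real.sq_sqrt (Finset.sum_nonneg fun _ _ => sq_nonneg _),
      Fintype.sum_sum_type]
    simp only [Real.dist_eq, sq_abs, ha, hb]
  have hA : (∑ l, (θ (Sum.inl l) - θ' (Sum.inl l)) * ω l) ^ 2 ≤ a * S :=
    Finset.sum_mul_sq_le_sq_mul_sq _ _ _
  have hB : (∑ l, (θ (Sum.inr l) - θ' (Sum.inr l)) * ω l ^ 2) ^ 2 ≤ b * S ^ 2 := by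
    refine (Finset.sum_mul_sq_le_sq_mul_sq _ _ _).trans (mul_le_mul_of_nonneg_left ?_ hb0)
    exact Finset.sum_sq_le_sq_sum_of_nonneg fun _ _ => sq_nonneg _
  refine abs_le_of_sq_le_sq' ?_ (by positivity) |>.2
  rw [mul_pow, mul_pow, hdist, ← Real.exp_nat_mul, Complex.sq_norm, Complex.normSq_apply]
  simp only [Complex.sub_re, Complex.sub_im]
  have e1 : -(∑ l, θ (Sum.inr l) * ω l ^ 2) / 2 - -(∑ l, θ' (Sum.inr l) * ω l ^ 2) / 2 =
      -(∑ l, (θ (Sum.inr l) - θ' (Sum.inr l)) * ω l ^ 2) / 2 := by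
    simp only [sub_mul, Finset.sum_sub_distrib]; ring
  have e2 : -∑ l, θ (Sum.inl l) * ω l - -∑ l, θ' (Sum.inl l) * ω l =
      -∑ l, (θ (Sum.inl l) - θ' (Sum.inl l)) * ω l := by
    simp only [sub_mul, Finset.sum_sub_distrib]; ring
  rw [e1, e2, show ((2 : ℕ) : ℝ) * (-(v * S) / 2) = -(v * S) by push_cast; ring]
  have h1 := mul_le_mul_of_nonneg_left hA (Real.exp_pos (-(v * S))).le
  have h2 := mul_le_mul_of_nonneg_left hB (Real.exp_pos (-(v * S))).le
  have h3 := mul_le_mul_of_nonneg_left hE1 ha0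
  have h4 := mul_le_mul_of_nonneg_left hE2 hb0
  nlinarith

theorem norm_sketch_sub_sq {m : ℕ} (w : Fin m → Space d) (P Q : Measure (Space d)) :
    ‖sketch w P - sketch w Q‖ ^ 2 = (m : ℝ)⁻¹ * ∑ j, ‖charFn P (w j) - charFn Q (w j)‖ ^ 2 := by
  rw [EuclideanSpace.norm_sq_eq, Finset.mul_sum]
  refine Finset.sum_congr rfl fun j _ => ?_
  simp only [sketch, PiLp.sub_apply]
  rw [← mul_sub, norm_mul, mul_pow, Complex.norm_real, Real.norm_eq_abs, sq_abs, div_pow,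
    Real.sq_sqrt (Nat.cast_nonneg _), one_pow, one_div]

/-- The factor 1/√m makes the sketch distance a root mean square over the frequencies, so a uniform
bound passes through without dependence on `m`. -/
theorem norm_sketch_sub_le {m : ℕ} (w : Fin m → Space d) {P Q : Measure (Space d)} {δ : ℝ}
    (hδ : ∀ ω, ‖charFn P ω - charFn Q ω‖ ≤ δ) : ‖sketch w P - sketch w Q‖ ≤ δ := by
  have hδ0 : 0 ≤ δ := (norm_nonneg _).trans (hδ 0)
  refine abs_le_of_sq_le_sq' ?_ hδ0 |>.2
  rw [norm_sketch_sub_sq]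
  have : ∑ j, ‖charFn P (w j) - charFn Q (w j)‖ ^ 2 ≤ m * δ ^ 2 := by
    simpa using Finset.sum_le_sum fun j (_ : j ∈ Finset.univ) =>
      pow_le_pow_left₀ (norm_nonneg _) (hδ (w j)) 2
  rcases Nat.eq_zero_or_pos m with rfl | hm
  · simp; positivity
  · rw [inv_mul_le_iff₀ (by positivity)]
    exact this

theorem norm_charFn_sub_le_two (P Q : ProbabilityMeasure (Space d)) (ω : Space d) :
    ‖charFn (P : Measure (Space d)) ω - charFn (Q : Measure (Space d)) ω‖ ≤ 2 :=
  (norm_sub_le _ _).trans (by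
    linarith [norm_charFn_le_one (P : Measure (Space d)) ω,
      norm_charFn_le_one (Q : Measure (Space d)) ω])

theorem measurable_norm_charFn_sub (P Q : ProbabilityMeasure (Space d)) :
    Measurable fun ω => ‖charFn (P : Measure (Space d)) ω - charFn (Q : Measure (Space d)) ω‖ :=
  ((measurable_charFn _).sub (measurable_charFn _)).norm

theorem mmd_nonneg (Λ : Measure (Space d)) (P Q : ProbabilityMeasure (Space d)) :
    0 ≤ mmd Λ P Q := Real.sqrt_nonneg _

theorem mmd_sq (Λ : Measure (Space d)) (P Q : ProbabilityMeasure (Space d)) :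
    mmd Λ P Q ^ 2 =
      ∫ ω, ‖charFn (P : Measure (Space d)) ω - charFn (Q : Measure (Space d)) ω‖ ^ 2 ∂Λ :=
  Real.sq_sqrt (integral_nonneg fun _ => sq_nonneg _)

/-- A triangle inequality for the maximum mean discrepancy. -/
theorem mmd_le_add_of_norm_charFn_sub_le (Λ : Measure (Space d)) [IsProbabilityMeasure Λ]
    {P Q R : ProbabilityMeasure (Space d)} {δ : ℝ}
    (hδ : ∀ ω, ‖charFn (P : Measure (Space d)) ω - charFn (Q : Measure (Space d)) ω‖ ≤ δ) :
    mmd Λ P R ≤ δ + mmd Λ Q R := by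
  have hδ0 : 0 ≤ δ := (norm_nonneg _).trans (hδ 0)
  set h : Space d → ℝ :=
    fun ω => ‖charFn (Q : Measure (Space d)) ω - charFn (R : Measure (Space d)) ω‖ with hh
  have hm : Measurable h := measurable_norm_charFn_sub Q R
  have hb : ∀ ω, ‖h ω‖ ≤ 2 := fun ω => by
    rw [Real.norm_eq_abs, abs_of_nonneg (norm_nonneg _)]; exact norm_charFn_sub_le_two Q R ω
  have hi : Integrable h Λ := Integrable.of_bound hm.aestronglyMeasurable 2 (.of_forall hb)
  have hL : MemLp h 2 Λ := MemLp.of_bound hm.aestronglyMeasurable 2 (.of_forall hb)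
  have hi2 : Integrable (fun ω => h ω ^ 2) Λ := hL.integrable_sq
  have hi1 : Integrable (fun ω => δ ^ 2 + 2 * δ * h ω) Λ :=
    (integrable_const _).add (hi.const_mul _)
  have hmono : mmd Λ P R ^ 2 ≤ ∫ ω, (δ ^ 2 + 2 * δ * h ω + h ω ^ 2) ∂Λ := by
    rw [mmd_sq]
    refine integral_mono_of_nonneg (.of_forall fun _ => sq_nonneg _)
      (hi1.add hi2) (.of_forall fun ω => ?_)
    have h1 : ‖charFn (P : Measure (Space d)) ω - charFn (R : Measure (Space d)) ω‖ ≤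
        δ + h ω := (norm_sub_le_norm_sub_add_norm_sub _ _ _).trans (by gcongr; exact hδ ω)
    have := pow_le_pow_left₀ (norm_nonneg _) h1 2
    simp only
    linarith [add_sq δ (h ω)]
  rw [integral_add hi1 hi2, integral_add (integrable_const _) (hi.const_mul _),
    integral_const_mul] at hmono
  -- Cauchy–Schwarz for the cross term of the expanded square, which completes (δ + mmd)².
  have hcs : ∫ ω, h ω ∂Λ ≤ mmd Λ Q R :=
    abs_le_of_sq_le_sq' ((sq_integral_le_integral_sq hL).trans_eq (mmd_sq Λ Q R).symm)
      (mmd_nonneg _ _ _) |>.2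
  refine abs_le_of_sq_le_sq' ?_ (add_nonneg hδ0 (mmd_nonneg _ _ _)) |>.2
  have e : mmd Λ Q R ^ 2 = ∫ ω, h ω ^ 2 ∂Λ := mmd_sq Λ Q R
  simp only [integral_const, probReal_univ, smul_eq_mul, one_mul] at hmono
  nlinarith [mul_le_mul_of_nonneg_left hcs hδ0]

end SketchedGMM

/-! ### Empirical means and the sketch of the data -/

/-- The mean square error of an empirical mean is at most `1 / n` times the
second moment. -/
theorem integral_pi_sq_integral_sub_mean_le {X : Type*} [MeasurableSpace X] {P : Measure X}
    [IsProbabilityMeasure P] {n : ℕ} (hn : 0 < n) {f : X → ℝ} (hf : MemLp f 2 P) :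
    ∫ x, (∫ y, f y ∂P - (n : ℝ)⁻¹ * ∑ i, f (x i)) ^ 2 ∂(Measure.pi fun _ : Fin n => P) ≤
      (n : ℝ)⁻¹ * ∫ y, f y ^ 2 ∂P := by
  have hn' : (0 : ℝ) < n := by exact_mod_cast hn
  have hi : ∀ i : Fin n, Integrable (fun x : Fin n → X => f (x i)) (Measure.pi fun _ => P) :=
    fun i => (measurePreserving_eval (fun _ : Fin n => P) i).integrable_comp_of_integrable
      (hf.integrable (by norm_num))
  have hL : ∀ i : Fin n, MemLp (fun x : Fin n → X => f (x i)) 2 (Measure.pi fun _ => P) :=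
    fun i => hf.comp_measurePreserving (measurePreserving_eval (fun _ : Fin n => P) i)
  have hvar := variance_sum_pi (μ := fun _ : Fin n => P) (X := fun _ => f) (fun _ => hf)
  have hmean : ∫ x, ∑ i, f (x i) ∂(Measure.pi fun _ : Fin n => P) = n * ∫ y, f y ∂P := by
    rw [integral_finsetSum _ fun i _ => hi i]
    have : ∀ i : Fin n, ∫ x : Fin n → X, f (x i) ∂(Measure.pi fun _ => P) = ∫ y, f y ∂P :=
      fun i => integral_comp_eval (μ := fun _ : Fin n => P) hf.aestronglyMeasurable
    simp [this]
  have hsum : (∑ i : Fin n, fun x : Fin n → X => f (x i)) = fun x => ∑ i, f (x i) := by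
    ext x; simp
  rw [hsum, variance_eq_integral
    (memLp_finsetSum _ fun i _ => hL i).aestronglyMeasurable.aemeasurable, hmean] at hvar
  have hv : variance f P ≤ ∫ y, f y ^ 2 ∂P := variance_le_expectation_sq hf.aestronglyMeasurable
  have e : ∀ x : Fin n → X, (∫ y, f y ∂P - (n : ℝ)⁻¹ * ∑ i, f (x i)) ^ 2 =
      ((n : ℝ)⁻¹) ^ 2 * (∑ i, f (x i) - n * ∫ y, f y ∂P) ^ 2 := fun x => by
    field_simp; ring
  simp_rw [e]
  rw [integral_const_mul, hvar]
  simp only [Finset.sum_const, Finset.card_univ, Fintype.card_fin, nsmul_eq_mul]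
  calc ((n : ℝ)⁻¹) ^ 2 * (n * variance f P) = (n : ℝ)⁻¹ * variance f P := by field_simp
    _ ≤ _ := by gcongr

/-- Real and imaginary parts are treated separately; their second moments add up to that of |f|, so
no factor 2 is lost. -/
theorem integral_pi_norm_sq_integral_sub_mean_le {X : Type*} [MeasurableSpace X] {P : Measure X}
    [IsProbabilityMeasure P] {n : ℕ} (hn : 0 < n) {f : X → ℂ} (hf : Measurable f)
    (h1 : ∀ x, ‖f x‖ ≤ 1) :
    ∫ x, ‖∫ y, f y ∂P - (n : ℂ)⁻¹ * ∑ i, f (x i)‖ ^ 2 ∂(Measure.pi fun _ : Fin n => P) ≤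
      (n : ℝ)⁻¹ := by
  have hfi : Integrable f P := Integrable.of_bound hf.aestronglyMeasurable 1 (.of_forall h1)
  have hre : MemLp (fun x => (f x).re) 2 P := MemLp.of_bound
    (Complex.measurable_re.comp hf).aestronglyMeasurable 1
    (.of_forall fun x => (Complex.abs_re_le_norm _).trans (h1 x))
  have him : MemLp (fun x => (f x).im) 2 P := MemLp.of_bound
    (Complex.measurable_im.comp hf).aestronglyMeasurable 1
    (.of_forall fun x => (Complex.abs_im_le_norm _).trans (h1 x))
  have hmem : ∀ g : X → ℝ, MemLp g 2 P → Integrable (fun x : Fin n → X =>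
      (∫ y, g y ∂P - (n : ℝ)⁻¹ * ∑ i, g (x i)) ^ 2) (Measure.pi fun _ => P) := fun g hg =>
    ((memLp_const _).sub ((memLp_finsetSum _ fun i _ => hg.comp_measurePreserving
      (measurePreserving_eval (fun _ : Fin n => P) i)).const_mul _)).integrable_sq
  have e : ∀ x : Fin n → X, ‖∫ y, f y ∂P - (n : ℂ)⁻¹ * ∑ i, f (x i)‖ ^ 2 =
      (∫ y, (f y).re ∂P - (n : ℝ)⁻¹ * ∑ i, (f (x i)).re) ^ 2 +
      (∫ y, (f y).im ∂P - (n : ℝ)⁻¹ * ∑ i, (f (x i)).im) ^ 2 := fun x => by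
    have r1 : (∫ y, f y ∂P).re = ∫ y, (f y).re ∂P := (integral_re hfi).symm
    have r2 : (∫ y, f y ∂P).im = ∫ y, (f y).im ∂P := (integral_im hfi).symm
    rw [← Complex.ofReal_natCast, ← Complex.ofReal_inv, Complex.sq_norm, Complex.normSq_apply,
      Complex.sub_re, Complex.sub_im, Complex.re_ofReal_mul, Complex.im_ofReal_mul,
      Complex.re_sum, Complex.im_sum, r1, r2]
    ring
  simp_rw [e]
  rw [integral_add (hmem _ hre) (hmem _ him)]
  refine (add_le_add (integral_pi_sq_integral_sub_mean_le hn hre)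
    (integral_pi_sq_integral_sub_mean_le hn him)).trans ?_
  rw [← mul_add, ← integral_add hre.integrable_sq him.integrable_sq]
  refine mul_le_of_le_one_right (by positivity) ?_
  have : ∫ y, ((f y).re ^ 2 + (f y).im ^ 2) ∂P ≤ ∫ _, (1 : ℝ) ∂P := by
    refine integral_mono (hre.integrable_sq.add him.integrable_sq) (integrable_const _) fun y => ?_
    have := pow_le_pow_left₀ (norm_nonneg _) (h1 y) 2
    rw [Complex.sq_norm, Complex.normSq_apply] at this
    simp only
    linarith
  simpa using this

namespace SketchedGMM

variable {d n m : ℕ}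

theorem charFn_empirical (x : Fin n → Space d) (ω : Space d) :
    charFn (empirical x) ω =
      (n : ℂ)⁻¹ * ∑ i, Complex.exp (-Complex.I * ((inner ℝ ω (x i) : ℝ) : ℂ)) := by
  rw [charFn, empirical, integral_smul_measure, integral_finsetSum_measure]
  · simp only [integral_dirac]
    simp [ENNReal.toReal_inv]
  · exact fun i _ => integrable_exp_neg_I_mul_inner _ _

theorem norm_charFn_empirical_le_one (x : Fin n → Space d) (ω : Space d) :
    ‖charFn (empirical x) ω‖ ≤ 1 := by
  rw [charFn_empirical, norm_mul, norm_inv, Complex.norm_natCast]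
  have : ‖∑ i, Complex.exp (-Complex.I * ((inner ℝ ω (x i) : ℝ) : ℂ))‖ ≤ n := by
    refine (norm_sum_le _ _).trans_eq ?_
    simp [norm_exp_neg_I_mul, -neg_mul]
  exact inv_mul_le_one_of_le₀ this (Nat.cast_nonneg _)

/-- Changing one item changes the empirical characteristic function by at most `2 / n`. -/
theorem norm_charFn_empirical_sub_update_le (x : Fin n → Space d) (i : Fin n) (y : Space d)
    (ω : Space d) :
    ‖charFn (empirical x) ω - charFn (empirical (Function.update x i y)) ω‖ ≤ 2 / n := by
  rw [charFn_empirical, charFn_empirical, ← mul_sub, norm_mul, norm_inv, Complex.norm_natCast,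
    ← Finset.sum_sub_distrib, Finset.sum_eq_single i]
  · rw [div_eq_inv_mul]
    refine mul_le_mul_of_nonneg_left ((norm_sub_le _ _).trans ?_) (by positivity)
    rw [norm_exp_neg_I_mul, norm_exp_neg_I_mul]
    norm_num
  · intro k _ hk
    rw [Function.update_of_ne hk, sub_self]
  · simp

/-- Reduces measurability of sketch distances to that of characteristic functions. -/
theorem norm_sketch_sub_eq_sqrt (w : Fin m → Space d) (P Q : Measure (Space d)) :
    ‖sketch w P - sketch w Q‖ =
      Real.sqrt ((m : ℝ)⁻¹ * ∑ j, ‖charFn P (w j) - charFn Q (w j)‖ ^ 2) := by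
  rw [← norm_sketch_sub_sq, Real.sqrt_sq (norm_nonneg _)]

/-- The sketching error of the empirical distribution is jointly measurable in the items and the
frequencies. -/
theorem measurable_norm_sketch_sub_sketch_empirical (P : Measure (Space d)) [IsFiniteMeasure P] :
    Measurable fun z : (Fin n → Space d) × (Fin m → Space d) =>
      ‖sketch z.2 P - sketch z.2 (empirical z.1)‖ := by
  simp_rw [norm_sketch_sub_eq_sqrt, charFn_empirical]
  have h1 := measurable_charFn P
  fun_prop

theorem measurable_norm_sketch_sub_sketch_empirical_left (P : Measure (Space d))
    [IsFiniteMeasure P] (w : Fin m → Space d) :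
    Measurable fun x : Fin n → Space d => ‖sketch w P - sketch w (empirical x)‖ := by
  simp_rw [norm_sketch_sub_eq_sqrt, charFn_empirical]
  fun_prop

/-- The expected sketching error of the empirical distribution is at most `1 / √n`. -/
theorem integral_norm_sketch_sub_sketch_empirical_le (P : Measure (Space d))
    [IsProbabilityMeasure P] (hn : 0 < n) (w : Fin m → Space d) :
    ∫ x, ‖sketch w P - sketch w (empirical x)‖ ∂(Measure.pi fun _ : Fin n => P) ≤
      1 / Real.sqrt n := by
  have hm : Measurable fun x : Fin n → Space d => ‖sketch w P - sketch w (empirical x)‖ :=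
    measurable_norm_sketch_sub_sketch_empirical_left P w
  have hb : ∀ x : Fin n → Space d, ∀ ω, ‖charFn P ω - charFn (empirical x) ω‖ ≤ 2 := fun x ω =>
    (norm_sub_le _ _).trans (by
      linarith [norm_charFn_le_one P ω, norm_charFn_empirical_le_one x ω])
  have hL : MemLp (fun x : Fin n → Space d => ‖sketch w P - sketch w (empirical x)‖) 2
      (Measure.pi fun _ => P) := MemLp.of_bound hm.aestronglyMeasurable 2
    (.of_forall fun x => by rw [norm_norm]; exact norm_sketch_sub_le w (hb x))
  refine abs_le_of_sq_le_sq' ?_ (by positivity) |>.2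
  rw [div_pow, one_pow, Real.sq_sqrt (Nat.cast_nonneg _)]
  refine (sq_integral_le_integral_sq hL).trans ?_
  simp_rw [norm_sketch_sub_sq]
  have hcm : ∀ j, Measurable fun x : Fin n → Space d =>
      ‖charFn P (w j) - charFn (empirical x) (w j)‖ ^ 2 := fun j => by
    simp_rw [charFn_empirical]
    fun_prop
  rw [integral_const_mul, integral_finsetSum _ fun j _ => Integrable.of_bound
    (hcm j).aestronglyMeasurable (2 ^ 2) (.of_forall fun x => by
      rw [norm_pow, norm_norm]; exact pow_le_pow_left₀ (norm_nonneg _) (hb x _) 2)]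
  have hj : ∀ j, ∫ x, ‖charFn P (w j) - charFn (empirical x) (w j)‖ ^ 2
      ∂(Measure.pi fun _ : Fin n => P) ≤ (n : ℝ)⁻¹ := fun j => by
    simp_rw [charFn_empirical]
    exact integral_pi_norm_sq_integral_sub_mean_le hn (measurable_exp_neg_I_mul_inner (w j))
      fun _ => (norm_exp_neg_I_mul _).le
  have hs : ∑ j, ∫ x, ‖charFn P (w j) - charFn (empirical x) (w j)‖ ^ 2
      ∂(Measure.pi fun _ : Fin n => P) ≤ m * (n : ℝ)⁻¹ := by
    simpa using Finset.sum_le_sum fun j (_ : j ∈ Finset.univ) => hj j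
  rw [one_div]
  rcases Nat.eq_zero_or_pos m with rfl | hm0
  · simp
  · rw [inv_mul_le_iff₀ (by positivity)]
    exact hs

/-- The sketch of the empirical distribution concentrates around the sketch of the data
distribution. -/
theorem measureReal_pi_norm_sketch_sub_sketch_empirical_le (P : Measure (Space d))
    [IsProbabilityMeasure P] (hn : 0 < n) (w : Fin m → Space d) {ρ : ℝ} (hρ : 0 < ρ)
    (hρ1 : ρ ≤ 2) :
    (Measure.pi fun _ : Fin n => P).real
      {x | (1 + Real.sqrt (2 * Real.log (2 / ρ))) / Real.sqrt n ≤
        ‖sketch w P - sketch w (empirical x)‖} ≤ ρ / 2 := by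
  have hn' : (0 : ℝ) < n := by exact_mod_cast hn
  have hlog : 0 ≤ Real.log (2 / ρ) := Real.log_nonneg (by rwa [one_le_div hρ])
  have hm : Measurable fun x : Fin n → Space d => ‖sketch w P - sketch w (empirical x)‖ :=
    measurable_norm_sketch_sub_sketch_empirical_left P w
  -- With differences 2/n McDiarmid's exponent is -nt²/2, and this `t` makes the tail exactly ρ/2.
  have h := measureReal_pi_ge_le_of_bounded_differences (P := P) (c := 2 / n)
    (t := Real.sqrt (2 * Real.log (2 / ρ)) / Real.sqrt n) hn (by positivity) (by positivity)
    (fun x => ‖sketch w P - sketch w (empirical x)‖) hm (M := 2)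
    (fun x => by
      rw [abs_of_nonneg (norm_nonneg _)]
      exact norm_sketch_sub_le w fun ω => (norm_sub_le _ _).trans (by
        linarith [norm_charFn_le_one P ω, norm_charFn_empirical_le_one x ω]))
    (fun x i y => by
      refine (abs_norm_sub_norm_le _ _).trans ?_
      rw [sub_sub_sub_cancel_left, norm_sub_rev]
      exact norm_sketch_sub_le w fun ω => norm_charFn_empirical_sub_update_le x i y ω)
  refine (measureReal_mono ?_).trans (h.trans_eq ?_)
  · intro x hx
    have := integral_norm_sketch_sub_sketch_empirical_le P hn w
    simp only [Set.mem_ofPred_eq, add_div] at hx ⊢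
    linarith
  · have : -2 * (Real.sqrt (2 * Real.log (2 / ρ)) / Real.sqrt n) ^ 2 / (n * (2 / (n : ℝ)) ^ 2) =
        -Real.log (2 / ρ) := by
      rw [div_pow, Real.sq_sqrt (by positivity), Real.sq_sqrt hn'.le]
      field_simp
    rw [this, Real.exp_neg, Real.exp_log (by positivity), inv_div]

end SketchedGMM

/-! ### Mixtures: parametrisation, existence of minimisers, nets -/

namespace SketchedGMM

variable {d K m : ℕ}

instance isProbabilityMeasure_gaussian (θ : Param d) : IsProbabilityMeasure (gaussian θ) := by
  unfold gaussian; infer_instance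

theorem charFn_sum_smul (α : Fin K → NNReal) (P : Fin K → Measure (Space d))
    [∀ k, IsFiniteMeasure (P k)] (ω : Space d) :
    charFn (∑ k, α k • P k) ω = ∑ k, ((α k : ℝ) : ℂ) * charFn (P k) ω := by
  rw [charFn, integral_finsetSum_measure fun k _ => integrable_exp_neg_I_mul_inner _ _]
  refine Finset.sum_congr rfl fun k _ => ?_
  rw [integral_smul_nnreal_measure]
  exact NNReal.smul_def _ _ |>.trans (Complex.real_smul)

/-- Together with its converse below, this moves compactness and covering arguments from measures to
the parameter space T^K × simplex. -/
theorem exists_mem_gmm_of_mem_stdSimplex {T : Set (Param d)} {θ : Fin K → Param d}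
    {α : Fin K → ℝ} (hθ : ∀ k, θ k ∈ T) (hα : α ∈ stdSimplex ℝ (Fin K)) :
    ∃ P ∈ gmm K T, ∀ ω, charFn (P : Measure (Space d)) ω =
      ∑ k, (α k : ℂ) * charFn (gaussian (θ k)) ω := by
  let a : Fin K → NNReal := fun k => ⟨α k, hα.1 k⟩
  have ha : ∑ k, a k = 1 := by
    apply NNReal.coe_injective
    push_cast
    exact hα.2
  let P : Measure (Space d) := ∑ k, a k • gaussian (θ k)
  have hP : IsProbabilityMeasure P := ⟨by
    simp only [P, Measure.coe_finsetSum, Finset.sum_apply, Measure.smul_apply, measure_univ]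
    simp only [ENNReal.smul_def, smul_eq_mul, mul_one]
    exact_mod_cast ha⟩
  exact ⟨⟨P, hP⟩, ⟨θ, a, hθ, ha, rfl⟩, fun ω => charFn_sum_smul a _ ω⟩

theorem exists_mem_stdSimplex_of_mem_gmm {T : Set (Param d)} {P : ProbabilityMeasure (Space d)}
    (hP : P ∈ gmm K T) :
    ∃ (θ : Fin K → Param d) (α : Fin K → ℝ), (∀ k, θ k ∈ T) ∧ α ∈ stdSimplex ℝ (Fin K) ∧
      ∀ ω, charFn (P : Measure (Space d)) ω = ∑ k, (α k : ℂ) * charFn (gaussian (θ k)) ω := by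
  obtain ⟨θ, α, hθ, hα, hP⟩ := hP
  refine ⟨θ, fun k => α k, hθ, ⟨fun k => (α k).2, ?_⟩, fun ω => ?_⟩
  · change ∑ k, (α k : ℝ) = 1
    exact_mod_cast congrArg NNReal.toReal hα
  · rw [hP, charFn_sum_smul]

theorem isCompact_setOf_variance {T : Set (Param d)} (hT : IsCompact T) :
    IsCompact {v : ℝ | ∃ θ ∈ T, ∃ l : Fin d, v = θ.variance l} := by
  have : {v : ℝ | ∃ θ ∈ T, ∃ l : Fin d, v = θ.variance l} =
      ⋃ l : Fin d, (fun θ : Param d => θ.variance l) '' T := by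
    ext v
    simp only [Set.mem_ofPred_eq, Set.mem_iUnion, Set.mem_image]
    grind
  rw [this]
  refine isCompact_iUnion fun l => hT.image ?_
  unfold Param.variance
  fun_prop

/-- Compactness makes the infimum an attained variance. For `d = 0` the set of variances would be
empty and `sInf` would take the default value 0. -/
theorem minVariance_pos (hd : 0 < d) {T : Set (Param d)} (hT : IsCompact T) (hne : T.Nonempty)
    (hpos : ∀ θ ∈ T, ∀ l, 0 < θ.variance l) : 0 < minVariance T := by
  obtain ⟨θ, hθ⟩ := hne
  obtain ⟨κ, hκ, l, h⟩ := (isCompact_setOf_variance hT).sInf_mem ⟨_, θ, hθ, ⟨0, hd⟩, rfl⟩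
  rw [minVariance, h]
  exact hpos κ hκ l

theorem minVariance_le {T : Set (Param d)} (hT : IsCompact T) {θ : Param d} (hθ : θ ∈ T)
    (l : Fin d) : minVariance T ≤ θ.variance l :=
  csInf_le (isCompact_setOf_variance hT).bddBelow ⟨θ, hθ, l, rfl⟩

/-- The decoder is well defined. -/
theorem decoderSet_nonempty (hd : 0 < d) (hK : 0 < K) {T : Set (Param d)} (hT : IsCompact T)
    (hne : T.Nonempty) (hpos : ∀ θ ∈ T, ∀ l, 0 < θ.variance l)
    (z : EuclideanSpace ℂ (Fin m)) (w : Fin m → Space d) :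
    (decoderSet (gmm K T) z w).Nonempty := by
  -- Sketches of mixtures are the image of a compact parameter set under this map, which is
  -- continuous there by the Lipschitz bound.
  let G : (Fin K → Param d) × (Fin K → ℝ) → EuclideanSpace ℂ (Fin m) := fun p =>
    WithLp.toLp 2 fun j => ((1 / Real.sqrt m : ℝ) : ℂ) *
      ∑ k, (p.2 k : ℂ) * charFn (gaussian (p.1 k)) (w j)
  let S : Set ((Fin K → Param d) × (Fin K → ℝ)) :=
    (Set.univ.pi fun _ => T) ×ˢ stdSimplex ℝ (Fin K)
  have hS : IsCompact S := (isCompact_univ_pi fun _ => hT).prod (isCompact_stdSimplex ℝ (Fin K))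
  have hSne : S.Nonempty := by
    obtain ⟨θ, hθ⟩ := hne
    exact ⟨(fun _ => θ, Pi.single ⟨0, hK⟩ 1), fun _ _ => hθ, single_mem_stdSimplex ℝ _⟩
  have hcont : ∀ ω, ContinuousOn (fun θ : Param d => charFn (gaussian θ) ω) T := fun ω => by
    refine (LipschitzOnWith.of_dist_le_mul (K := Real.toNNReal (max (Real.sqrt (minVariance T))⁻¹
      ((minVariance T)⁻¹ / Real.sqrt 2))) fun θ hθ θ' hθ' => ?_).continuousOn
    rw [dist_eq_norm, Real.coe_toNNReal _ (le_max_of_le_left (by positivity))]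
    exact norm_charFn_gaussian_sub_le (minVariance_pos hd hT hne hpos) (minVariance_le hT hθ)
      (minVariance_le hT hθ') ω
  have hG : ContinuousOn (fun p => ‖z - G p‖) S := by
    refine (continuousOn_const.sub ?_).norm
    refine (PiLp.continuous_toLp 2 _).comp_continuousOn (continuousOn_pi.2 fun j => ?_)
    refine continuousOn_const.mul (continuousOn_finsetSum _ fun k _ => ContinuousOn.mul ?_ ?_)
    · exact Continuous.continuousOn (by fun_prop)
    · exact (hcont (w j)).comp (f := fun p : (Fin K → Param d) × (Fin K → ℝ) => p.1 k)
        (Continuous.continuousOn (by fun_prop)) fun p hp => hp.1 k trivial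
  obtain ⟨p, hp, hmin⟩ := hS.exists_isMinOn hSne hG
  have hsk : ∀ (P : Measure (Space d)) (θ : Fin K → Param d) (α : Fin K → ℝ),
      (∀ ω, charFn P ω = ∑ k, (α k : ℂ) * charFn (gaussian (θ k)) ω) →
      sketch w P = G (θ, α) := fun P θ α h => by
    simp only [sketch, G, h]
  obtain ⟨P, hP, hPc⟩ := exists_mem_gmm_of_mem_stdSimplex (fun k => hp.1 k trivial) hp.2
  refine ⟨P, hP, fun Q hQ => ?_⟩
  obtain ⟨θ, α, hθ, hα, hQc⟩ := exists_mem_stdSimplex_of_mem_gmm hQ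
  rw [hsk _ _ _ hPc, hsk _ _ _ hQc]
  exact hmin (a := (θ, α)) ⟨fun k _ => hθ k, hα⟩

/-- Changing the components under fixed weights costs a convex average of errors at most δ; changing
the weights costs their ℓ¹ distance, as characteristic functions are bounded by one. -/
theorem norm_sum_mul_charFn_sub_le {θ θ' : Fin K → Param d} {α α' : Fin K → ℝ}
    (hα : α ∈ stdSimplex ℝ (Fin K)) {δ : ℝ} {ω : Space d}
    (h : ∀ k, ‖charFn (gaussian (θ k)) ω - charFn (gaussian (θ' k)) ω‖ ≤ δ) :
    ‖∑ k, (α k : ℂ) * charFn (gaussian (θ k)) ω - ∑ k, (α' k : ℂ) * charFn (gaussian (θ' k)) ω‖ ≤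
      δ + ∑ k, |α k - α' k| := by
  rw [← Finset.sum_sub_distrib]
  refine (norm_sum_le _ _).trans ?_
  have hk : ∀ k, ‖(α k : ℂ) * charFn (gaussian (θ k)) ω -
      (α' k : ℂ) * charFn (gaussian (θ' k)) ω‖ ≤ α k * δ + |α k - α' k| := fun k => by
    have e : (α k : ℂ) * charFn (gaussian (θ k)) ω - (α' k : ℂ) * charFn (gaussian (θ' k)) ω =
        (α k : ℂ) * (charFn (gaussian (θ k)) ω - charFn (gaussian (θ' k)) ω) +
          ((α k - α' k : ℝ) : ℂ) * charFn (gaussian (θ' k)) ω := by push_cast; ring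
    rw [e]
    refine (norm_add_le _ _).trans ?_
    rw [norm_mul, norm_mul, Complex.norm_real, Complex.norm_real, Real.norm_eq_abs,
      Real.norm_eq_abs, abs_of_nonneg (hα.1 k)]
    exact add_le_add (mul_le_mul_of_nonneg_left (h k) (hα.1 k))
      (mul_le_of_le_one_right (abs_nonneg _) (norm_charFn_le_one _ _))
  refine (Finset.sum_le_sum fun k _ => hk k).trans_eq ?_
  rw [Finset.sum_add_distrib, ← Finset.sum_mul, hα.2, one_mul]

/-- The simplex has an `ℓ¹` net with at most `(1 + 2 / ε) ^ K` points. -/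
theorem exists_finset_net_stdSimplex (K : ℕ) {ε : ℝ} (hε : 0 < ε) :
    ∃ s : Finset (Fin K → ℝ), (s : Set (Fin K → ℝ)) ⊆ stdSimplex ℝ (Fin K) ∧
      (s.card : ℝ) ≤ (1 + 2 / ε) ^ K ∧
      ∀ α ∈ stdSimplex ℝ (Fin K), ∃ β ∈ s, ∑ k, |α k - β k| ≤ ε := by
  classical
  -- In the ℓ¹ norm the simplex lies in the unit ball, and the general net lemma then measures error
  -- in ℓ¹.
  let A : Set (PiLp 1 fun _ : Fin K => ℝ) := {x | WithLp.ofLp x ∈ stdSimplex ℝ (Fin K)}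
  have hA : A ⊆ Metric.closedBall 0 1 := fun x hx => by
    rw [mem_closedBall_zero_iff, PiLp.norm_eq_of_L1]
    have : ∀ k, ‖x k‖ = x k := fun k => Real.norm_of_nonneg (hx.1 k)
    simp_rw [this]
    exact hx.2.le
  obtain ⟨s, hsA, hcard, hs⟩ := exists_finset_net_of_subset_closedBall hε zero_le_one hA
  have hfin : Module.finrank ℝ (PiLp 1 fun _ : Fin K => ℝ) = K := by
    rw [(WithLp.linearEquiv 1 ℝ (Fin K → ℝ)).finrank_eq, Module.finrank_fin_fun]
  rw [hfin, mul_one] at hcard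
  refine ⟨s.image WithLp.ofLp, ?_, ?_, fun α hα => ?_⟩
  · intro α hα
    obtain ⟨x, hx, rfl⟩ := Finset.mem_image.1 hα
    exact hsA hx
  · exact le_trans (by exact_mod_cast Finset.card_image_le) hcard
  · obtain ⟨y, hy, hxy⟩ := hs (WithLp.toLp 1 α) hα
    refine ⟨_, Finset.mem_image_of_mem _ hy, ?_⟩
    rw [dist_eq_norm, PiLp.norm_eq_of_L1] at hxy
    simpa using hxy

/-- A net of the set of mixtures, for the uniform distance of characteristic functions. -/
theorem exists_finset_net_gmm (K : ℕ) {T : Set (Param d)} {v r δ : ℝ} {c : Param d}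
    (hv : 0 < v) (hTv : ∀ θ ∈ T, ∀ l, v ≤ θ.variance l) (hr : 0 ≤ r)
    (hTr : T ⊆ Metric.closedBall c r) (hδ : 0 < δ) :
    ∃ N : Finset (ProbabilityMeasure (Space d)),
      (N.card : ℝ) ≤ ((1 + 2 * (max (Real.sqrt v)⁻¹ (v⁻¹ / Real.sqrt 2) * r) / δ) ^ (2 * d)) ^ K *
        (1 + 2 / δ) ^ K ∧
      ∀ P ∈ gmm K T, ∃ Q ∈ N, ∀ ω,
        ‖charFn (P : Measure (Space d)) ω - charFn (Q : Measure (Space d)) ω‖ ≤ 2 * δ := by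
  classical
  set M := max (Real.sqrt v)⁻¹ (v⁻¹ / Real.sqrt 2) with hM
  have hM0 : 0 < M := lt_max_of_lt_left (by positivity)
  -- Radius δ/M turns into error δ under the Lipschitz constant M; the weights cost another δ. The
  -- nets are internal, so their points keep variances at least `v` and weights in the simplex.
  obtain ⟨s, hsT, hscard, hs⟩ := exists_finset_net_of_subset_closedBall (div_pos hδ hM0) hr hTr
  obtain ⟨t, htA, htcard, ht⟩ := exists_finset_net_stdSimplex K hδ
  have hex : ∀ p : (Fin K → Param d) × (Fin K → ℝ), (∀ k, p.1 k ∈ T) ∧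
      p.2 ∈ stdSimplex ℝ (Fin K) → ∃ P : ProbabilityMeasure (Space d),
        ∀ ω, charFn (P : Measure (Space d)) ω = ∑ k, (p.2 k : ℂ) * charFn (gaussian (p.1 k)) ω :=
    fun p hp => by
      obtain ⟨P, -, hP⟩ := exists_mem_gmm_of_mem_stdSimplex hp.1 hp.2
      exact ⟨P, hP⟩
  choose! F hF using hex
  refine ⟨((Fintype.piFinset fun _ : Fin K => s) ×ˢ t).image F, ?_, fun P hP => ?_⟩
  · have h1 : ((((Fintype.piFinset fun _ : Fin K => s) ×ˢ t).image F).card : ℝ) ≤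
        (s.card : ℝ) ^ K * t.card := by
      have := Finset.card_image_le (s := (Fintype.piFinset fun _ : Fin K => s) ×ˢ t) (f := F)
      rw [Finset.card_product, Fintype.card_piFinset_const] at this
      exact_mod_cast this
    have hfin : Module.finrank ℝ (Param d) = 2 * d := by
      rw [finrank_euclideanSpace, Fintype.card_sum, Fintype.card_fin]; ring
    rw [hfin, show 2 * r / (δ / M) = 2 * (M * r) / δ by field_simp] at hscard
    exact h1.trans (mul_le_mul (pow_le_pow_left₀ (Nat.cast_nonneg _) hscard _) htcard
      (Nat.cast_nonneg _) (by positivity))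
  · obtain ⟨θ, α, hθ, hα, hPc⟩ := exists_mem_stdSimplex_of_mem_gmm hP
    choose θ' hθ' hθθ' using fun k => hs (θ k) (hθ k)
    obtain ⟨α', hα', hαα'⟩ := ht α hα
    refine ⟨F (θ', α'), Finset.mem_image_of_mem _ (Finset.mem_product.2
      ⟨Fintype.mem_piFinset.2 hθ', hα'⟩), fun ω => ?_⟩
    rw [hPc, hF (θ', α') ⟨fun k => hsT (hθ' k), htA hα'⟩]
    refine (norm_sum_mul_charFn_sub_le (δ := δ) hα fun k => ?_).trans (by linarith)
    refine (norm_charFn_gaussian_sub_le hv (hTv _ (hθ k)) (hTv _ (hsT (hθ' k))) ω).trans ?_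
    rw [← hM, mul_comm, ← le_div_iff₀ hM0]
    exact hθθ' k

theorem chebyshevRadius_nonneg (T : Set (Param d)) : 0 ≤ chebyshevRadius T :=
  Real.sInf_nonneg fun _ h => h.1.le

theorem constB_nonneg (T : Set (Param d)) : 0 ≤ constB T :=
  mul_nonneg (mul_nonneg (by norm_num) (le_max_of_le_left (by positivity)))
    (chebyshevRadius_nonneg T)

/-- The set of mixtures has an `η / 8`-net whose size is controlled by `constC`. -/
theorem exists_finset_net_gmm_card_le (K : ℕ) (hd : 0 < d) {T : Set (Param d)} (hT : IsCompact T)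
    (hne : T.Nonempty) (hpos : ∀ θ ∈ T, ∀ l, 0 < θ.variance l) {η : ℝ} (hη : 0 < η)
    (hη1 : η ≤ 1) :
    ∃ N : Finset (ProbabilityMeasure (Space d)),
      (N.card : ℝ) ≤ (constC T / η) ^ (2 * K * (2 * d + 1)) ∧
      ∀ P ∈ gmm K T, ∃ Q ∈ N, ∀ ω,
        ‖charFn (P : Measure (Space d)) ω - charFn (Q : Measure (Space d)) ω‖ ≤ η / 8 := by
  have hv := minVariance_pos hd hT hne hpos
  set v := minVariance T with hvdef
  set M := max (Real.sqrt v)⁻¹ (v⁻¹ / Real.sqrt 2) with hM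
  have hM0 : 0 < M := lt_max_of_lt_left (by positivity)
  have hB0 := constB_nonneg T
  have hB : constB T = 8 * M * chebyshevRadius T := rfl
  -- The infimum of admissible radii need not be admissible; the slack 1/(8M) becomes the +1 in B +
  -- 1.
  obtain ⟨r, ⟨hr0, c, hTr⟩, hr⟩ : ∃ r ∈ {r : ℝ | 0 < r ∧ ∃ c : Param d, T ⊆ Metric.closedBall c r},
      r < chebyshevRadius T + 1 / (8 * M) := by
    refine Real.lt_sInf_add_pos ?_ (by positivity)
    obtain ⟨r, hr⟩ := hT.isBounded.subset_closedBall 0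
    exact ⟨max r 1, by positivity, 0, hr.trans
      (Metric.closedBall_subset_closedBall (le_max_left _ _))⟩
  have hMr : 8 * (M * r) ≤ constB T + 1 := by
    have := mul_le_mul_of_nonneg_left hr.le (by positivity : 0 ≤ 8 * M)
    rw [mul_add, mul_one_div_cancel (by positivity)] at this
    linarith
  obtain ⟨N, hcard, hN⟩ := exists_finset_net_gmm K hv (fun θ hθ l => minVariance_le hT hθ l)
    hr0.le hTr (by positivity : 0 < η / 16)
  refine ⟨N, hcard.trans ?_, fun P hP => ?_⟩
  · rw [← hM]
    -- Each of the 2dK + K covering factors is at most (C/η)², whence the exponent 2K(2d+1). Since η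
    -- ≤ 1 and 32Mr ≤ 4(B+1), the constant 48 leaves room.
    have hC : (constC T / η) ^ 2 = 48 * (constB T + 1) / η ^ 2 := by
      rw [div_pow, constC, Real.sq_sqrt (by positivity)]
    have hηη : η ^ 2 ≤ η := by nlinarith
    have h1 : 1 + 2 * (M * r) / (η / 16) ≤ (constC T / η) ^ 2 := by
      rw [hC, le_div_iff₀ (by positivity)]
      have : (1 + 2 * (M * r) / (η / 16)) * η ^ 2 = η ^ 2 + 32 * (M * r) * η := by
        field_simp; ring
      rw [this]
      nlinarith
    have h2 : 1 + 2 / (η / 16) ≤ (constC T / η) ^ 2 := by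
      rw [hC, le_div_iff₀ (by positivity)]
      have : (1 + 2 / (η / 16)) * η ^ 2 = η ^ 2 + 32 * η := by
        field_simp; ring
      rw [this]
      nlinarith
    have hCpos : 0 ≤ (constC T / η) ^ 2 := sq_nonneg _
    calc _ ≤ (((constC T / η) ^ 2) ^ (2 * d)) ^ K * ((constC T / η) ^ 2) ^ K := by gcongr
      _ = _ := by ring
  · obtain ⟨Q, hQ, h⟩ := hN P hP
    exact ⟨Q, hQ, fun ω => (h ω).trans_eq (by ring)⟩

end SketchedGMM

/-! ### Sketch distance against MMD, and the recovery guarantee -/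

namespace SketchedGMM

variable {d m n : ℕ}

theorem mmd_comm (Λ : Measure (Space d)) (P Q : ProbabilityMeasure (Space d)) :
    mmd Λ P Q = mmd Λ Q P := by
  simp only [mmd, norm_sub_rev]

theorem measurable_norm_sketch_sub (P Q : Measure (Space d)) [IsFiniteMeasure P]
    [IsFiniteMeasure Q] :
    Measurable fun w : Fin m → Space d => ‖sketch w P - sketch w Q‖ := by
  simp_rw [norm_sketch_sub_eq_sqrt]
  have h1 := measurable_charFn P
  have h2 := measurable_charFn Q
  fun_prop

/-- For a fixed pair of distributions, the distance of the sketches controls the maximum mean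
discrepancy up to `η / 2`, except with exponentially small probability. -/
theorem measureReal_pi_norm_sketch_sub_lt_mmd_le (Λ : Measure (Space d)) [IsProbabilityMeasure Λ]
    (hm : 0 < m) (P Q : ProbabilityMeasure (Space d)) {η : ℝ} (hη : 0 < η) :
    (Measure.pi fun _ : Fin m => Λ).real
      {w | 2 * ‖sketch w (P : Measure (Space d)) - sketch w (Q : Measure (Space d))‖ + η / 2 <
        mmd Λ P Q} ≤ Real.exp (-(m * η ^ 2 / 48)) := by
  have hm' : (0 : ℝ) < m := by exact_mod_cast hm
  set f : Space d → ℝ :=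
    fun ω => ‖charFn (P : Measure (Space d)) ω - charFn (Q : Measure (Space d)) ω‖ ^ 2 with hf
  have hmmd : mmd Λ P Q ^ 2 = ∫ ω, f ω ∂Λ := mmd_sq Λ P Q
  by_cases hg : mmd Λ P Q ≤ η / 2
  · have : {w : Fin m → Space d | 2 * ‖sketch w (P : Measure (Space d)) -
        sketch w (Q : Measure (Space d))‖ + η / 2 < mmd Λ P Q} = ∅ := by
      refine Set.eq_empty_of_forall_notMem fun w hw => ?_
      rw [Set.mem_ofPred_eq] at hw
      linarith [norm_nonneg (sketch w (P : Measure (Space d)) - sketch w (Q : Measure (Space d)))]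
    rw [this, measureReal_empty]
    exact (Real.exp_pos _).le
  -- On the event the sketch distance is below γ/2, so the empirical mean is at most γ²/4; γ > η/2
  -- turns the exponent mγ²/12 into at least mη²/48.
  push Not at hg
  have h := measureReal_pi_sum_le_quarter_le (P := Λ) (m := m) (f := f)
    ((measurable_norm_charFn_sub P Q).pow_const 2) (fun _ => sq_nonneg _) (fun ω => by
      have := pow_le_pow_left₀ (norm_nonneg _) (norm_charFn_sub_le_two P Q ω) 2
      norm_num at this
      exact this)
  refine (measureReal_mono fun w hw => ?_).trans (h.trans (Real.exp_le_exp.2 ?_))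
  · rw [Set.mem_ofPred_eq] at hw
    set a := ‖sketch w (P : Measure (Space d)) - sketch w (Q : Measure (Space d))‖ with ha
    have ha0 : 0 ≤ a := norm_nonneg _
    have ha2 : a ^ 2 = (m : ℝ)⁻¹ * ∑ j, f (w j) := norm_sketch_sub_sq w _ _
    have h4 : a ^ 2 ≤ (∫ ω, f ω ∂Λ) / 4 := by
      rw [← hmmd]
      nlinarith [mmd_nonneg Λ P Q]
    rw [ha2, inv_mul_le_iff₀ hm'] at h4
    exact h4
  · rw [← hmmd]
    have : η ^ 2 / 4 ≤ mmd Λ P Q ^ 2 := by nlinarith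
    nlinarith

/-- The deterministic part of the recovery guarantee: accuracy of the decoder when the sketch of
the data is accurate and the sketching operator is well behaved on a net of the model. -/
theorem mmd_le_of_mem_decoderSet {Λ : Measure (Space d)} [IsProbabilityMeasure Λ]
    {model : Set (ProbabilityMeasure (Space d))} {Pstar P₀ Pbar : ProbabilityMeasure (Space d)}
    {N : Finset (ProbabilityMeasure (Space d))} {η t : ℝ} {w : Fin m → Space d}
    {z : EuclideanSpace ℂ (Fin m)} (hP₀ : P₀ ∈ model)
    (hN : ∀ P ∈ model, ∃ Q ∈ N, ∀ ω,
      ‖charFn (P : Measure (Space d)) ω - charFn (Q : Measure (Space d)) ω‖ ≤ η / 8)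
    (hw : ∀ Q ∈ N, mmd Λ Q P₀ ≤
      2 * ‖sketch w (Q : Measure (Space d)) - sketch w (P₀ : Measure (Space d))‖ + η / 2)
    (hz : ‖sketch w (Pstar : Measure (Space d)) - z‖ ≤ t)
    (hPbar : Pbar ∈ decoderSet model z w) :
    mmd Λ Pstar Pbar ≤ 5 * tvDist Pstar P₀ + 4 * t + 7 / 8 * η := by
  obtain ⟨Q, hQN, hQ⟩ := hN Pbar hPbar.1
  have h1 : mmd Λ Pstar Pbar ≤ tvDist Pstar P₀ + mmd Λ P₀ Pbar :=
    mmd_le_add_of_norm_charFn_sub_le Λ (norm_charFn_sub_le_tvDist Pstar P₀)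
  have h2 : mmd Λ Pbar P₀ ≤ η / 8 + mmd Λ Q P₀ := mmd_le_add_of_norm_charFn_sub_le Λ hQ
  have h3 := hw Q hQN
  have h4 : ‖sketch w (Pbar : Measure (Space d)) - sketch w (Q : Measure (Space d))‖ ≤ η / 8 :=
    norm_sketch_sub_le w hQ
  have h5 : ‖sketch w (Pstar : Measure (Space d)) - sketch w (P₀ : Measure (Space d))‖ ≤
      tvDist Pstar P₀ := norm_sketch_sub_le w (norm_charFn_sub_le_tvDist Pstar P₀)
  have h6 := hPbar.2 P₀ hP₀
  have h7 := norm_sub_le_norm_sub_add_norm_sub (sketch w (Q : Measure (Space d)))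
    (sketch w (Pbar : Measure (Space d))) (sketch w (P₀ : Measure (Space d)))
  have h8 := norm_sub_le_norm_sub_add_norm_sub (sketch w (Pbar : Measure (Space d))) z
    (sketch w (P₀ : Measure (Space d)))
  have h9 := norm_sub_le_norm_sub_add_norm_sub z (sketch w (Pstar : Measure (Space d)))
    (sketch w (P₀ : Measure (Space d)))
  rw [norm_sub_rev _ (sketch w (Pbar : Measure (Space d)))] at h7
  rw [norm_sub_rev _ z] at h8
  rw [norm_sub_rev z (sketch w (Pstar : Measure (Space d)))] at h9
  rw [mmd_comm Λ P₀] at h1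
  -- The total is TV + η/8 + η/2 + 2(η/8 + 2(t + TV)); the inner factor 2 comes from the optimality
  -- of the decoder.
  linarith

/-- The joint law of the items and the frequencies is a product measure. -/
theorem map_prodMk_eq_prod_pi {Ω : Type*} [MeasurableSpace Ω] {μ : Measure Ω}
    [IsProbabilityMeasure μ] {P Λ : Measure (Space d)} [IsProbabilityMeasure P]
    [IsProbabilityMeasure Λ] {x : Fin n → Ω → Space d} {freq : Fin m → Ω → Space d}
    (hx : ∀ i, Measurable (x i)) (hfreq : ∀ j, Measurable (freq j))
    (hx_law : ∀ i, μ.map (x i) = P) (hfreq_law : ∀ j, μ.map (freq j) = Λ)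
    (hindep : iIndepFun (Sum.elim x freq : Fin n ⊕ Fin m → Ω → Space d) μ) :
    μ.map (fun ω => ((fun i => x i ω, fun j => freq j ω) :
      (Fin n → Space d) × (Fin m → Space d))) =
      (Measure.pi fun _ => P).prod (Measure.pi fun _ => Λ) := by
  have hmeas : ∀ s, Measurable (Sum.elim x freq s) := by
    rintro (i | j)
    exacts [hx i, hfreq j]
  have h := (iIndepFun_iff_map_fun_eq_pi_map fun s => (hmeas s).aemeasurable).1 hindep
  have hlaw : (fun s => μ.map (Sum.elim x freq s)) = Sum.elim (fun _ => P) (fun _ => Λ) := by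
    ext1 s
    rcases s with i | j
    exacts [hx_law i, hfreq_law j]
  rw [hlaw] at h
  have : ∀ s, SigmaFinite (Sum.elim (fun _ : Fin n => P) (fun _ : Fin m => Λ) s) := by
    rintro (i | j) <;> simp only [Sum.elim_inl, Sum.elim_inr] <;> infer_instance
  have hmp := (measurePreserving_sumPiEquivProdPi (X := fun _ : Fin n ⊕ Fin m => Space d)
    (Sum.elim (fun _ => P) (fun _ => Λ))).map_eq
  rw [← h, Measure.map_map (MeasurableEquiv.measurable _) (measurable_pi_lambda _ hmeas)] at hmp
  exact hmp

/-- The probabilistic part of the recovery guarantee. -/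
theorem measure_prod_pi_bad_le (P Λ : ProbabilityMeasure (Space d)) (hn : 0 < n) (hm : 0 < m)
    {η ρ : ℝ} (hη : 0 < η) (hρ : 0 < ρ) (hρ2 : ρ ≤ 2) (P₀ : ProbabilityMeasure (Space d))
    (N : Finset (ProbabilityMeasure (Space d)))
    (hN : N.card * Real.exp (-(m * η ^ 2 / 48)) ≤ ρ / 2) :
    ((Measure.pi fun _ : Fin n => (P : Measure (Space d))).prod
      (Measure.pi fun _ : Fin m => (Λ : Measure (Space d))))
      ({z | (1 + Real.sqrt (2 * Real.log (2 / ρ))) / Real.sqrt n ≤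
          ‖sketch z.2 (P : Measure (Space d)) - sketch z.2 (empirical z.1)‖} ∪
        ⋃ Q ∈ N, Prod.snd ⁻¹' {w | 2 * ‖sketch w (Q : Measure (Space d)) -
          sketch w (P₀ : Measure (Space d))‖ + η / 2 < mmd (Λ : Measure (Space d)) Q P₀}) ≤
      ENNReal.ofReal ρ := by
  have hle : ∀ {X : Type} [MeasurableSpace X] (κ : Measure X) [IsProbabilityMeasure κ] (s : Set X)
      {a : ℝ}, κ.real s ≤ a → κ s ≤ ENNReal.ofReal a := fun κ _ s a h => by
    rw [← ofReal_measureReal]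
    exact ENNReal.ofReal_le_ofReal h
  rw [← add_halves ρ, ENNReal.ofReal_add (by positivity) (by positivity), add_halves]
  refine (measure_union_le _ _).trans (add_le_add ?_ ?_)
  -- Fubini: the concentration bound over the items holds for each fixed choice of frequencies.
  · rw [Measure.prod_apply_symm (measurableSet_le measurable_const
      (measurable_norm_sketch_sub_sketch_empirical _))]
    calc _ ≤ ∫⁻ _ : Fin m → Space d, ENNReal.ofReal (ρ / 2)
            ∂(Measure.pi fun _ => (Λ : Measure (Space d))) :=
          lintegral_mono fun w => hle _ _
            (measureReal_pi_norm_sketch_sub_sketch_empirical_le (P : Measure (Space d)) hn w hρ hρ2)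
      _ = _ := by simp
  · refine (measure_biUnion_finset_le _ _).trans ?_
    have hQ : ∀ Q ∈ N, ((Measure.pi fun _ : Fin n => (P : Measure (Space d))).prod
        (Measure.pi fun _ : Fin m => (Λ : Measure (Space d))))
        (Prod.snd ⁻¹' {w | 2 * ‖sketch w (Q : Measure (Space d)) -
          sketch w (P₀ : Measure (Space d))‖ + η / 2 < mmd (Λ : Measure (Space d)) Q P₀}) ≤
        ENNReal.ofReal (Real.exp (-(m * η ^ 2 / 48))) := fun Q _ => by
      rw [measurePreserving_snd.measure_preimage (measurableSet_lt
        (((measurable_norm_sketch_sub _ _).const_mul 2).add_const _)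
          measurable_const).nullMeasurableSet]
      exact hle _ _ (measureReal_pi_norm_sketch_sub_lt_mmd_le (Λ : Measure (Space d)) hm Q P₀ hη)
    refine (Finset.sum_le_card_nsmul _ _ _ hQ).trans ?_
    rw [nsmul_eq_mul, ← ENNReal.ofReal_natCast, ← ENNReal.ofReal_mul (Nat.cast_nonneg _)]
    exact ENNReal.ofReal_le_ofReal hN

/-- Makes log(C/η) positive, so that the lower bound on `m` forces m > 0. -/
theorem one_lt_constC_div (T : Set (Param d)) {η : ℝ} (hη : 0 < η) (hη1 : η ≤ 1) :
    1 < constC T / η := by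
  rw [one_lt_div hη, constC]
  refine hη1.trans_lt (Real.lt_sqrt_of_sq_lt ?_)
  linarith [constB_nonneg T]

end SketchedGMM

theorem mainTheorem2
    {d K n m : ℕ} (hd : 0 < d) (hK : 0 < K) (hn : 0 < n)
    -- a nonempty compact set of parameters, with positive variances
    (T : Set (Param d)) (hT : IsCompact T) (hT_ne : T.Nonempty)
    (hT_pos : ∀ θ ∈ T, ∀ l, 0 < θ.variance l)
    -- an arbitrary frequency distribution and an arbitrary data distribution
    (Λ Pstar : ProbabilityMeasure (Space d))
    (η : ℝ) (hη : 0 < η) (hη_le : η ≤ 1) (ρ : ℝ) (hρ : 0 < ρ)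
    (hm : 48 * η⁻¹ ^ 2 *
        (2 * (K : ℝ) * (2 * (d : ℝ) + 1) * Real.log (constC T / η) + Real.log (2 / ρ)) ≤ (m : ℝ))
    -- `n` items drawn from `Pstar` and `m` frequencies drawn from `Λ`, all independent
    {Ω : Type*} [MeasurableSpace Ω] (μ : Measure Ω) [IsProbabilityMeasure μ]
    (x : Fin n → Ω → Space d) (freq : Fin m → Ω → Space d)
    (hx : ∀ i, Measurable (x i)) (hfreq : ∀ j, Measurable (freq j))
    (hx_law : ∀ i, μ.map (x i) = (Pstar : Measure (Space d)))
    (hfreq_law : ∀ j, μ.map (freq j) = (Λ : Measure (Space d)))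
    (hindep : iIndepFun (Sum.elim x freq : Fin n ⊕ Fin m → Ω → Space d) μ) :
    -- the decoder is well defined: the minimization problem always has a solution
    (∀ (z : EuclideanSpace ℂ (Fin m)) (w : Fin m → Space d),
        (decoderSet (gmm K T) z w).Nonempty) ∧
    -- with probability at least `1 - ρ`, every possible decoder output satisfies the bound
    ∃ E : Set Ω, MeasurableSet E ∧ ENNReal.ofReal (1 - ρ) ≤ μ E ∧
      ∀ ω ∈ E,
        ∀ Pbar ∈ decoderSet (gmm K T)
            (sketch (fun j => freq j ω) (empirical fun i => x i ω)) (fun j => freq j ω),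
          mmd (Λ : Measure (Space d)) Pstar Pbar ≤
            5 * tvDistToModel Pstar (gmm K T)
              + 4 * (1 + Real.sqrt (2 * Real.log (2 / ρ))) / Real.sqrt n + η := by
  refine ⟨decoderSet_nonempty hd hK hT hT_ne hT_pos, ?_⟩
  rcases le_or_gt 1 ρ with hρ1 | hρ1
  · exact ⟨∅, MeasurableSet.empty, by simp [ENNReal.ofReal_eq_zero.2 (sub_nonpos.2 hρ1)],
      fun _ h => h.elim⟩
  have hC := one_lt_constC_div T hη hη_le
  have hlogC : 0 < Real.log (constC T / η) := Real.log_pos hC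
  have hlogρ : 0 < Real.log (2 / ρ) := Real.log_pos (by rw [one_lt_div hρ]; linarith)
  have hm_pos : 0 < m := by
    have : (0 : ℝ) < m := lt_of_lt_of_le (by positivity) hm
    exact_mod_cast this
  obtain ⟨N, hcard, hN⟩ := exists_finset_net_gmm_card_le K hd hT hT_ne hT_pos hη hη_le
  have hNρ : N.card * Real.exp (-(m * η ^ 2 / 48)) ≤ ρ / 2 := by
    -- After taking logarithms, this is the hypothesis on `m`.
    have hexp : (constC T / η) ^ (2 * K * (2 * d + 1)) * (2 / ρ) ≤ Real.exp (m * η ^ 2 / 48) := by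
      rw [← Real.log_le_iff_le_exp (by positivity), Real.log_mul (by positivity) (by positivity),
        Real.log_pow]
      push_cast
      have := mul_le_mul_of_nonneg_right hm (by positivity : 0 ≤ η ^ 2 / 48)
      refine le_trans (le_of_eq ?_) (this.trans_eq (by ring))
      field_simp
    rw [Real.exp_neg, ← div_eq_mul_inv, div_le_iff₀ (Real.exp_pos _)]
    refine hcard.trans ?_
    have := mul_le_mul_of_nonneg_left hexp (by positivity : 0 ≤ ρ / 2)
    refine le_trans (le_of_eq ?_) this
    field_simp
  -- Near-minimality avoids proving that the infimum is attained: 5 · η/40 = η/8 fills the gap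
  -- between 7η/8 and η. The dummy decoder problem only shows that the model is nonempty.
  obtain ⟨_, ⟨P₀, hP₀, rfl⟩, hP₀tv⟩ := Real.lt_sInf_add_pos
    (s := (fun Q => tvDist Pstar Q) '' gmm K T)
    (((decoderSet_nonempty hd hK hT hT_ne hT_pos 0 fun _ : Fin m => 0).mono fun _ h => h.1).image _)
    (by positivity : 0 < η / 40)
  set Φ : Ω → (Fin n → Space d) × (Fin m → Space d) :=
    fun ω => (fun i => x i ω, fun j => freq j ω) with hΦ
  have hΦm : Measurable Φ :=
    (measurable_pi_lambda _ hx).prodMk (measurable_pi_lambda _ hfreq)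
  have hbad := measure_prod_pi_bad_le Pstar Λ hn hm_pos hη hρ (by linarith) P₀ N hNρ
  rw [← map_prodMk_eq_prod_pi hx hfreq hx_law hfreq_law hindep] at hbad
  set S := {z : (Fin n → Space d) × (Fin m → Space d) |
      (1 + Real.sqrt (2 * Real.log (2 / ρ))) / Real.sqrt n ≤
        ‖sketch z.2 (Pstar : Measure (Space d)) - sketch z.2 (empirical z.1)‖} ∪
      ⋃ Q ∈ N, Prod.snd ⁻¹' {w : Fin m → Space d | 2 * ‖sketch w (Q : Measure (Space d)) -
        sketch w (P₀ : Measure (Space d))‖ + η / 2 < mmd (Λ : Measure (Space d)) Q P₀} with hS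
  have hSm : MeasurableSet S := by
    refine (measurableSet_le measurable_const
      (measurable_norm_sketch_sub_sketch_empirical _)).union (N.measurableSet_biUnion fun Q _ => ?_)
    exact measurable_snd (measurableSet_lt
      (((measurable_norm_sketch_sub _ _).const_mul 2).add_const _) measurable_const)
  rw [Measure.map_apply hΦm hSm] at hbad
  refine ⟨(Φ ⁻¹' S)ᶜ, (hΦm hSm).compl, ?_, fun ω hω Pbar hPbar => ?_⟩
  · rw [prob_compl_eq_one_sub (hΦm hSm), ENNReal.ofReal_sub _ hρ.le, ENNReal.ofReal_one]
    exact tsub_le_tsub_left hbad _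
  · have hω' : Φ ω ∉ S := hω
    simp only [hS, Set.mem_union, Set.mem_iUnion, not_or, not_exists, Set.mem_preimage,
      Set.mem_ofPred_eq, not_le, not_lt] at hω'
    have h := mmd_le_of_mem_decoderSet hP₀ hN hω'.2 hω'.1.le hPbar
    have htv : tvDist Pstar P₀ < tvDistToModel Pstar (gmm K T) + η / 40 := hP₀tv
    rw [mul_div_assoc]
    linarith
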